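/- Theorem 5.1. Let $\alpha,\beta,t$ be complex numbers with $|t|<1$ and $\alpha\neq 0$, and let $\sqrt t$ be either square root of $t$. Notation. For $r\ge 0$ let $\phi_r(t)=\prod_{k=1}^{r}(1-t^k)$, $[k]=\frac{1-t^k}{1-t}$ and $[m]!=\prod_{k=1}^{m}[k]$. For a partition $\mu=(\mu_1\ge\dots\ge\mu_N\ge 0)$ with exactly $N$ parts, zero parts included, let $m_i(\mu)$ be the number of $j$ with $\mu_j=i$ $(i\ge 0)$, let $v_\mu(t)=\prod_{i\ge 0}[m_i(\mu)]!$, and let $$P_\mu(z_1,\dots,z_N;t)=\frac1{v_\mu(t)}\sum_{w\in S_N}w\Big(z_1^{\mu_1}\cdots z_N^{\mu_N}\prod_{1\le i<j\le N}\frac{z_i-tz_j}{z_i-z_j}\Big)$$ be the Hall--Littlewood polynomial, where $w$ acts on the subscripts of the $z_i$. Let $H_m(z;t)=\sum_{i=0}^m z^i\frac{[m]!}{[m-i]!\,[i]!}$ be the Rogers--Szegő polynomials. For $x=(x_1,\dots,x_n)$ let $$\tilde\Delta_K^{(n)}(a,b,c,d)=\frac1{2^n n!}\prod_{1\le i\le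 n}\frac{1-x_i^{\pm2}}{(1-ax_i^{\pm1})(1-bx_i^{\pm1})(1-cx_i^{\pm1})(1-dx_i^{\pm1})}\prod_{1\le i<j\le n}\frac{1-x_i^{\pm1}x_j^{\pm1}}{1-tx_i^{\pm1}x_j^{\pm1}},$$ where a factor containing the sign $\pm$ stands for the product over all choices of the signs (so $1-x_i^{\pm2}=(1-x_i^2)(1-x_i^{-2})$), and let $\pm1$, $\pm t$, $\pm\sqrt t$ in the list of parameters abbreviate $1,-1$; $t,-t$; $\sqrt t,-\sqrt t$. All integrals $\int f\,dT$ are over the torus $|x_1|=\dots=|x_n|=1$ with $dT=\prod_j\frac{dx_j}{2\pi\sqrt{-1}\,x_j}$ (with $n-1$ in place of $n$ when the variables are $x_1,\dots,x_{n-1}$). In the arguments of $P_\mu$, $x_i^{\pm1}$ stands for the two entries $x_i,x_i^{-1}$. Then the normalizing integrals in the denominators below are nonzero, and the following identities hold. (i) (For $O(2n)$.) For every $n\ge1$ and every partition $\mu$ with $2n$ parts (zero parts included), $$\frac{1}{\int\tilde\Delta_K^{(n)}(\pm1,\pm\sqrt t)\,dT}\int P_\mu(x_1^{\pm1},\dots,x_n^{\pm1};t)\,\tilde\Delta_K^{(n)}(\pm1,\pm\sqrt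 t)\prod_{i=1}^n(1-\alpha x_i^{\pm1})(1-\beta x_i^{\pm1})\,dT$$ $$+\frac{(1-\alpha^2)(1-\beta^2)}{\int\tilde\Delta_K^{(n-1)}(\pm t,\pm\sqrt t)\,dT}\int P_\mu(x_1^{\pm1},\dots,x_{n-1}^{\pm1},1,-1;t)\,\tilde\Delta_K^{(n-1)}(\pm t,\pm\sqrt t)\prod_{i=1}^{n-1}(1-\alpha x_i^{\pm1})(1-\beta x_i^{\pm1})\,dT$$ $$=\frac{2\phi_{2n}(t)}{v_\mu(t)(1-t)^{2n}}\Big(\prod_{i\ge0}H_{m_{2i}(\mu)}(\alpha\beta;t)\prod_{i\ge0}H_{m_{2i+1}(\mu)}(\beta/\alpha;t)\Big)(-\alpha)^{\#\text{ of odd parts of }\mu}.$$ (ii) (For $O(2n+1)$.) For every $n\ge0$ and every partition $\mu$ with $2n+1$ parts (zero parts included), $$\frac{(1-\alpha)(1-\beta)}{\int\tilde\Delta_K^{(n)}(t,-1,\pm\sqrt t)\,dT}\int P_\mu(x_1^{\pm1},\dots,x_n^{\pm1},1;t)\,\tilde\Delta_K^{(n)}(t,-1,\pm\sqrt t)\prod_{i=1}^n(1-\alpha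 x_i^{\pm1})(1-\beta x_i^{\pm1})\,dT$$ $$+\frac{(1+\alpha)(1+\beta)}{\int\tilde\Delta_K^{(n)}(1,-t,\pm\sqrt t)\,dT}\int P_\mu(x_1^{\pm1},\dots,x_n^{\pm1},-1;t)\,\tilde\Delta_K^{(n)}(1,-t,\pm\sqrt t)\prod_{i=1}^n(1-\alpha x_i^{\pm1})(1-\beta x_i^{\pm1})\,dT$$ $$=\frac{2\phi_{2n+1}(t)}{v_\mu(t)(1-t)^{2n+1}}\Big(\prod_{i\ge0}H_{m_{2i}(\mu)}(\alpha\beta;t)\prod_{i\ge0}H_{m_{2i+1}(\mu)}(\beta/\alpha;t)\Big)(-\alpha)^{\#\text{ of odd parts of }\mu}.$$ -/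

import Mathlib

open Finset

/-! ### Hall-Littlewood polynomials -/

/-- The multiplicity `m_i(μ)`: the number of parts of `μ = (μ_1, …, μ_N)` equal to `i`
(parts equal to zero are counted when `i = 0`). -/
def partMult {N : ℕ} (μ : Fin N → ℕ) (i : ℕ) : ℕ :=
  #{j : Fin N | μ j = i}

/-- The number of odd parts of `μ`. -/
def numOddParts {N : ℕ} (μ : Fin N → ℕ) : ℕ :=
  #{j : Fin N | Odd (μ j)}

/-- The `t`-integer `[k] = (1 - t^k) / (1 - t)`. -/
noncomputable def tInt (t : ℂ) (k : ℕ) : ℂ :=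
  (1 - t ^ k) / (1 - t)

/-- The `t`-factorial `[m]! = [m] [m-1] ⋯ [1]`. -/
noncomputable def tFactorial (t : ℂ) (m : ℕ) : ℂ :=
  ∏ k ∈ range m, tInt t (k + 1)

/-- `φ_r(t) = (1 - t) (1 - t^2) ⋯ (1 - t^r)`. -/
noncomputable def hlPhi (r : ℕ) (t : ℂ) : ℂ :=
  ∏ k ∈ range r, (1 - t ^ (k + 1))

/-- `v_μ(t) = ∏_{i ≥ 0} [m_i(μ)]!`; only finitely many factors differ from `[0]! = 1`. -/
noncomputable def hlV {N : ℕ} (μ : Fin N → ℕ) (t : ℂ) : ℂ :=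
  ∏ᶠ i : ℕ, tFactorial t (partMult μ i)

/-- The value at a point `z` with distinct coordinates of the symmetric rational expression
`∑_{w ∈ S_N} w (z^μ ∏_{i < j} (z_i - t z_j) / (z_i - z_j))`. -/
noncomputable def hlSum {N : ℕ} (μ : Fin N → ℕ) (t : ℂ) (z : Fin N → ℂ) : ℂ :=
  ∑ w : Equiv.Perm (Fin N), (∏ i, z (w i) ^ μ i) *
    ∏ i, ∏ j ∈ Ioi i, (z (w i) - t * z (w j)) / (z (w i) - z (w j))

section Existence

open MvPolynomial

variable {N : ℕ}

/-- Substitution of `X j` for `X i`. -/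
noncomputable def substVar (i j : Fin N) : MvPolynomial (Fin N) ℂ →ₐ[ℂ] MvPolynomial (Fin N) ℂ :=
  aeval fun k => if k = i then X j else X k

theorem sub_dvd_iff_substVar (i j : Fin N) (p : MvPolynomial (Fin N) ℂ) :
    X i - X j ∣ p ↔ substVar i j p = 0 := by
  constructor
  · rintro ⟨c, rfl⟩
    rw [map_mul]
    have : substVar i j (X i - X j) = 0 := by
      simp [substVar]
    rw [this, zero_mul]
  · intro h
    have key : (Ideal.Quotient.mkₐ ℂ (Ideal.span {X i - X j})).comp (substVar i j) =
        Ideal.Quotient.mkₐ ℂ (Ideal.span {(X i - X j : MvPolynomial (Fin N) ℂ)}) := by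
      apply MvPolynomial.algHom_ext
      intro k
      by_cases hk : k = i
      · subst hk
        simp only [substVar, AlgHom.comp_apply, aeval_X, if_true, Ideal.Quotient.mkₐ_eq_mk]
        rw [eq_comm, Ideal.Quotient.eq, Ideal.mem_span_singleton]
      · simp [substVar, hk]
    have h2 := DFunLike.congr_fun key p
    rw [AlgHom.comp_apply, h, map_zero, eq_comm, Ideal.Quotient.mkₐ_eq_mk,
      Ideal.Quotient.eq_zero_iff_mem, Ideal.mem_span_singleton] at h2
    exact h2

theorem prime_X_sub_X {i j : Fin N} (hij : i ≠ j) :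
    Prime (X i - X j : MvPolynomial (Fin N) ℂ) := by
  refine ⟨?_, ?_, ?_⟩
  · rw [sub_ne_zero]
    exact fun h => hij (X_injective h)
  · intro hu
    have h0 : substVar i j (X i - X j) = 0 := (sub_dvd_iff_substVar i j _).1 dvd_rfl
    have := hu.map (substVar i j)
    rw [h0] at this
    exact not_isUnit_zero this
  · intro a b hab
    rw [sub_dvd_iff_substVar, map_mul, mul_eq_zero] at hab
    simpa only [sub_dvd_iff_substVar] using hab

theorem X_sub_X_dvd_X_sub_X {i j k l : Fin N} (hij : i < j) (hkl : k < l)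
    (h : (X i - X j : MvPolynomial (Fin N) ℂ) ∣ X k - X l) : i = k ∧ j = l := by
  rw [sub_dvd_iff_substVar, map_sub, sub_eq_zero] at h
  have hX : ∀ a : Fin N, substVar i j (X a) = X (if a = i then j else a) := by
    intro a
    by_cases ha : a = i <;> simp [substVar, ha]
  rw [hX, hX] at h
  have h := X_injective h
  split_ifs at h <;> omega

/-- The Vandermonde product `∏_{i < j} (X_i - X_j)`. -/
noncomputable def vandProd (N : ℕ) : MvPolynomial (Fin N) ℂ :=
  ∏ i, ∏ j ∈ Ioi i, (X i - X j)

theorem vandProd_dvd {p : MvPolynomial (Fin N) ℂ}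
    (h : ∀ i j : Fin N, i < j → (X i - X j) ∣ p) : vandProd N ∣ p := by
  rw [vandProd, Finset.prod_sigma']
  have : ∀ s : Finset (Sigma fun _ : Fin N => Fin N), (∀ x ∈ s, x.1 < x.2) →
      ∏ x ∈ s, (X x.1 - X x.2 : MvPolynomial (Fin N) ℂ) ∣ p := by
    intro s
    induction s using Finset.induction_on with
    | empty => simp
    | insert a s ha ih =>
      intro hs
      obtain ⟨c, hc⟩ := ih fun x hx => hs x (mem_insert_of_mem hx)
      have hlt := hs a (mem_insert_self a s)
      have hpr := prime_X_sub_X hlt.ne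
      have hd := h _ _ hlt
      rw [hc] at hd
      rw [prod_insert ha]
      rcases hpr.dvd_or_dvd hd with h1 | ⟨d, rfl⟩
      · obtain ⟨b, hb, hab⟩ := hpr.exists_mem_finset_dvd h1
        obtain ⟨h1, h2⟩ := X_sub_X_dvd_X_sub_X hlt (hs b (mem_insert_of_mem hb)) hab
        have hab' : a = b := Sigma.ext h1 (heq_of_eq h2)
        exact absurd (hab' ▸ hb) ha
      · exact ⟨d, by rw [hc]; ring⟩
  exact this _ (by simp)

/-- The antisymmetrization of `X^μ ∏_{i < j} (X_i - t X_j)`. -/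
noncomputable def hlNum (μ : Fin N → ℕ) (t : ℂ) : MvPolynomial (Fin N) ℂ :=
  ∑ w : Equiv.Perm (Fin N), ((Equiv.Perm.sign w : ℤ) : MvPolynomial (Fin N) ℂ) *
    rename w ((∏ i, X i ^ μ i) * ∏ i, ∏ j ∈ Ioi i, (X i - C t * X j))

theorem rename_swap_hlNum (μ : Fin N → ℕ) (t : ℂ) {i j : Fin N} (hij : i ≠ j) :
    rename (Equiv.swap i j) (hlNum μ t) = -hlNum μ t := by
  rw [hlNum, map_sum, ← Finset.sum_neg_distrib]
  refine Fintype.sum_equiv (Equiv.mulLeft (Equiv.swap i j)) _ _ fun w => ?_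
  rw [map_mul, map_intCast, rename_rename]
  simp [Equiv.Perm.sign_swap hij]

theorem vandProd_dvd_hlNum (μ : Fin N → ℕ) (t : ℂ) : vandProd N ∣ hlNum μ t := by
  refine vandProd_dvd fun i j hij => ?_
  rw [sub_dvd_iff_substVar]
  have h1 : (substVar i j).comp (rename (Equiv.swap i j)) = substVar i j := by
    apply MvPolynomial.algHom_ext
    intro k
    simp only [substVar, AlgHom.comp_apply, rename_X, aeval_X, Equiv.swap_apply_def]
    split_ifs <;> simp_all
  have h2 := DFunLike.congr_fun h1 (hlNum μ t)
  rw [AlgHom.comp_apply, rename_swap_hlNum μ t hij.ne, map_neg] at h2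
  exact self_eq_neg.1 h2.symm

theorem eval_vandProd_ne_zero {z : Fin N → ℂ} (hz : Function.Injective z) :
    eval z (vandProd N) ≠ 0 := by
  simp only [vandProd, map_prod, map_sub, eval_X]
  refine prod_ne_zero_iff.2 fun i _ => prod_ne_zero_iff.2 fun j hj => ?_
  rw [sub_ne_zero]
  exact fun h => (mem_Ioi.1 hj).ne (hz h)

theorem eval_hlNum (μ : Fin N → ℕ) (t : ℂ) {z : Fin N → ℂ} (hz : Function.Injective z) :
    eval z (hlNum μ t) = eval z (vandProd N) * hlSum μ t z := by
  rw [hlNum, hlSum, map_sum, mul_sum]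
  refine sum_congr rfl fun w _ => ?_
  have hs := w.prod_Ioi_comp_eq_sign_mul_prod (f := fun i j => z i - z j) (by intros; ring)
  have hne : ∏ i, ∏ j ∈ Ioi i, (z (w i) - z (w j)) ≠ 0 := by
    have := eval_vandProd_ne_zero (z := z ∘ w) (hz.comp w.injective)
    simpa [vandProd] using this
  have hv : eval z (vandProd N) = ∏ i, ∏ j ∈ Ioi i, (z i - z j) := by simp [vandProd]
  have hsq : ((Equiv.Perm.sign w : ℤ) : ℂ) * ((Equiv.Perm.sign w : ℤ) : ℂ) = 1 := by
    rcases Int.units_eq_one_or (Equiv.Perm.sign w) with h | h <;> simp [h]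
  have hv' : eval z (vandProd N) =
      ((Equiv.Perm.sign w : ℤ) : ℂ) * ∏ i, ∏ j ∈ Ioi i, (z (w i) - z (w j)) := by
    rw [hs, ← mul_assoc, hsq, one_mul, hv]
  rw [hv']
  simp only [prod_div_distrib, map_mul, map_intCast, eval_rename, map_prod, map_pow, map_sub,
    eval_X, eval_C, Function.comp_apply]
  field_simp

theorem existsUnique_hlR (μ : Fin N → ℕ) (t : ℂ) :
    ∃! p : MvPolynomial (Fin N) ℂ,
      ∀ z : Fin N → ℂ, Function.Injective z → eval z p = hlSum μ t z := by
  obtain ⟨p, hp⟩ := vandProd_dvd_hlNum μ t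
  have hp' : ∀ z : Fin N → ℂ, Function.Injective z → eval z p = hlSum μ t z := by
    intro z hz
    have h := eval_hlNum μ t hz
    rw [hp, map_mul] at h
    exact mul_left_cancel₀ (eval_vandProd_ne_zero hz) h
  refine ⟨p, hp', fun q hq => ?_⟩
  have hv0 : vandProd N ≠ 0 := by
    intro h
    have := eval_vandProd_ne_zero (N := N) (z := fun i => ((i : ℕ) : ℂ))
      (fun a b hab => Fin.ext (by simpa using hab))
    simp [h] at this
  refine mul_left_cancel₀ hv0 (MvPolynomial.funext fun z => ?_)
  by_cases hz : Function.Injective z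
  · rw [map_mul, map_mul, hq z hz, hp' z hz]
  · have : eval z (vandProd N) = 0 := by
      simp only [Function.Injective, not_forall] at hz
      obtain ⟨a, b, hab, hne⟩ := hz
      simp only [vandProd, map_prod, map_sub, eval_X]
      rcases lt_or_gt_of_ne hne with h | h
      · exact prod_eq_zero (mem_univ a) (prod_eq_zero (mem_Ioi.2 h) (by rw [hab, sub_self]))
      · exact prod_eq_zero (mem_univ b) (prod_eq_zero (mem_Ioi.2 h) (by rw [hab, sub_self]))
    rw [map_mul, map_mul, this, zero_mul, zero_mul]

end Existence

/-- The polynomial `R_μ(x_1, …, x_N; t) = ∑_{w ∈ S_N} w (x^μ ∏_{i < j} (x_i - t x_j) / (x_i - x_j))`.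
The sum of rational functions is a polynomial; it is the unique one that takes the values `hlSum`
at all points with distinct coordinates. -/
noncomputable def hlR {N : ℕ} (μ : Fin N → ℕ) (t : ℂ) : MvPolynomial (Fin N) ℂ :=
  (existsUnique_hlR μ t).choose

theorem eval_hlR {N : ℕ} (μ : Fin N → ℕ) (t : ℂ) {z : Fin N → ℂ} (hz : Function.Injective z) :
    MvPolynomial.eval z (hlR μ t) = hlSum μ t z :=
  (existsUnique_hlR μ t).choose_spec.1 z hz

/-- The value at `z` of the Hall-Littlewood polynomial `P_μ(x_1, …, x_N; t) = R_μ / v_μ(t)`. -/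
noncomputable def hallLittlewood {N : ℕ} (μ : Fin N → ℕ) (t : ℂ) (z : Fin N → ℂ) : ℂ :=
  (hlV μ t)⁻¹ * MvPolynomial.eval z (hlR μ t)

/-! ### Rogers-Szegő polynomials -/

/-- The Rogers-Szegő polynomial `H_m(z; t) = ∑_{i=0}^m z^i [m]! / ([m-i]! [i]!)`. -/
noncomputable def rogersSzego (m : ℕ) (z t : ℂ) : ℂ :=
  ∑ i ∈ range (m + 1), z ^ i * (tFactorial t m / (tFactorial t (m - i) * tFactorial t i))

/-! ### The density and the integrals -/

/-- The symmetric Koornwinder density at `q = 0`, with parameters `a, b, c, d; t`: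
`(2^n n!)⁻¹ ∏_i (1 - x_i^{±2}) / ((1 - a x_i^{±1}) (1 - b x_i^{±1}) (1 - c x_i^{±1}) (1 - d x_i^{±1}))
  ∏_{i < j} (1 - x_i^{±1} x_j^{±1}) / (1 - t x_i^{±1} x_j^{±1})`,
where an expression with `±` stands for the product over all choices of the signs. -/
noncomputable def koornwinderDensity {n : ℕ} (a b c d t : ℂ) (x : Fin n → ℂ) : ℂ :=
  1 / (2 ^ n * (n.factorial : ℂ)) *
    (∏ i, (1 - x i ^ 2) * (1 - (x i)⁻¹ ^ 2) /
      (((1 - a * x i) * (1 - a * (x i)⁻¹)) * ((1 - b * x i) * (1 - b * (x i)⁻¹)) *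
        ((1 - c * x i) * (1 - c * (x i)⁻¹)) * ((1 - d * x i) * (1 - d * (x i)⁻¹)))) *
    ∏ i, ∏ j ∈ Ioi i,
      ((1 - x i * x j) * (1 - (x i)⁻¹ * (x j)⁻¹) * (1 - (x i)⁻¹ * x j) * (1 - x i * (x j)⁻¹)) /
      ((1 - t * (x i * x j)) * (1 - t * ((x i)⁻¹ * (x j)⁻¹)) *
        (1 - t * ((x i)⁻¹ * x j)) * (1 - t * (x i * (x j)⁻¹)))

/-- `∫_T f dT`, where `T` is the torus `|x_1| = ⋯ = |x_n| = 1` and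
`dT = ∏_j dx_j / (2 π √-1 x_j)`. -/
noncomputable def torusMean {n : ℕ} (f : (Fin n → ℂ) → ℂ) : ℂ :=
  torusIntegral (fun x => (∏ j, (2 * (Real.pi : ℂ) * Complex.I * x j)⁻¹) * f x)
    (fun _ => 0) (fun _ => 1)

/-- The alphabet `x_1^{±1}, …, x_n^{±1}`. -/
noncomputable def pmVars {n : ℕ} (x : Fin n → ℂ) : Fin (2 * n) → ℂ :=
  Fin.append x (fun i => (x i)⁻¹) ∘ Fin.cast (two_mul n)

/-- The weight `∏_i (1 - α x_i^{±1}) (1 - β x_i^{±1})`. -/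
noncomputable def abWeight {n : ℕ} (α β : ℂ) (x : Fin n → ℂ) : ℂ :=
  ∏ i, ((1 - α * x i) * (1 - α * (x i)⁻¹)) * ((1 - β * x i) * (1 - β * (x i)⁻¹))

/-- The right-hand side, for a partition `μ` with `N` parts (zero parts included). -/
noncomputable def orthogonalValue {N : ℕ} (μ : Fin N → ℕ) (α β t : ℂ) : ℂ :=
  2 * hlPhi N t / (hlV μ t * (1 - t) ^ N) *
    (((∏ᶠ i : ℕ, rogersSzego (partMult μ (2 * i)) (α * β) t) *
      ∏ᶠ i : ℕ, rogersSzego (partMult μ (2 * i + 1)) (β / α) t) *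
        (-α) ^ numOddParts μ)

/-!
Fix `N` and symmetrize `∏ fᵢ(zᵢ)` instead of a monomial (`symSum`), for `N` arbitrary functions
`fᵢ` of one variable. The left-hand sides of the identities are obtained from an evaluation of
the integral of such a symmetrization, over each of the four components of the orthogonal
groups, in terms of the values `fᵢ(1)` and `fᵢ(-1)` alone.

*Peeling off a variable.* On the even component of `O(2n)`, expand the symmetrization according
to the torus variable `x` or `x⁻¹` that comes first, and then according to the position of its
inverse. All the factors that couple `x` to the other variables cancel against the density
(`prod_mul_prod_mul_prod_crossFactor`), at the cost of twisting the functions between the two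
positions by `(t - x u) / (1 - t x u)`. What is left is a divided difference
`(F x - F x⁻¹) / (x - x⁻¹)`, where `F` extends to the disc as soon as each `x fᵢ(x) fⱼ(x⁻¹)`,
`i < j`, does (`IsAdmissible`). Hence its integral over `x` is `π (F 1 - F (-1))`
(`ExtendsToDisc.integral_sub_inv_div`). At `x = ±1` the twists are signs at the points `u = ±1`,
so that the sums over positions telescope, and induction on `n` gives a nonzero multiple of
`∏ (fᵢ(1) + fᵢ(-1)) + ∏ (fᵢ(1) - fᵢ(-1))` (`exists_integral_symSum_mul_evenDensity`).

*The other components* have the fixed eigenvalues `1` or `-1` in addition. The factors that a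
fixed eigenvalue contributes turn the density into the one of the smaller alphabet, and the sum
over its positions telescopes in the same way (`IsOrthogonalComponent.adjoin`). The two
components of the same group then yield the sum and the difference of the same two products, so
that their normalized means add up to `2 [N]! / 2 ^ N ∏ (fᵢ(1) + fᵢ(-1))`; the normalization
comes from the symmetrization of `1`, which is `[N]!` (`symSum_one`).

*The parameters.* For a partition `ν` the functions `u ^ νᵢ (1 - α u)` are admissible, and the
product is `2 ^ N (-α) ^ r` with `r` the number of odd parts. The factor `∏ (1 - β zₗ)` is
expanded into a sum over the sets of parts of `μ` that are raised by one. The exponents so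
obtained need not decrease, but they ascend by at most one, and each transposition that removes
an ascent contributes a factor `t` (`symSum_swap_castSucc`, `eq_prod_mul_of_swap_of_antitone`).
The resulting weighted sum over subsets factors over the values of the parts, and each factor is
a Rogers-Szegő polynomial by the `t`-Pascal rule (`sum_finset_eq_prod_rogersSzego`).
-/

/-! ### Symmetrizations of products of one-variable functions -/

/-- `∑_w ∏ᵢ fᵢ(z_{w i}) ∏_{i<j} (z_{w i} - t z_{w j}) / (z_{w i} - z_{w j})`: the Hall-Littlewood
symmetrization of `f₁ ⊗ ⋯ ⊗ f_N`, where the monomial of `hlSum` becomes a product of arbitrary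
one-variable functions. -/
noncomputable def symSum {N : ℕ} (t : ℂ) (f : Fin N → ℂ → ℂ) (z : Fin N → ℂ) : ℂ :=
  ∑ w : Equiv.Perm (Fin N), (∏ i, f i (z (w i))) *
    ∏ i, ∏ j ∈ Ioi i, (z (w i) - t * z (w j)) / (z (w i) - z (w j))

theorem hlSum_eq_symSum {N : ℕ} (μ : Fin N → ℕ) (t : ℂ) (z : Fin N → ℂ) :
    hlSum μ t z = symSum t (fun i u => u ^ μ i) z := rfl

theorem symSum_comp_perm {N : ℕ} (t : ℂ) (f : Fin N → ℂ → ℂ) (z : Fin N → ℂ)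
    (σ : Equiv.Perm (Fin N)) : symSum t f (z ∘ σ) = symSum t f z := by
  unfold symSum
  exact Fintype.sum_equiv (Equiv.mulLeft σ) _ _ fun w => by simp

theorem symSum_congr {N : ℕ} (t : ℂ) {f g : Fin N → ℂ → ℂ} {z : Fin N → ℂ}
    (h : ∀ i j, f i (z j) = g i (z j)) : symSum t f z = symSum t g z := by
  unfold symSum
  simp only [h]

theorem symSum_mul_common {N : ℕ} (t : ℂ) (f : Fin N → ℂ → ℂ) (c : ℂ → ℂ) (z : Fin N → ℂ) :
    symSum t (fun i u => f i u * c u) z = (∏ l, c (z l)) * symSum t f z := by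
  unfold symSum
  rw [mul_sum]
  refine sum_congr rfl fun w _ => ?_
  rw [prod_mul_distrib, Equiv.prod_comp w fun l => c (z l)]
  ring

/-- The permutation sending `p` to `q` and `p.succAbove i` to `q.succAbove (e i)`. -/
def permExtend {N : ℕ} (p q : Fin (N + 1)) (e : Equiv.Perm (Fin N)) : Equiv.Perm (Fin (N + 1)) :=
  (finSuccEquiv' p).trans (e.optionCongr.trans (finSuccEquiv' q).symm)

@[simp]
theorem permExtend_self {N : ℕ} (p q : Fin (N + 1)) (e : Equiv.Perm (Fin N)) :
    permExtend p q e p = q := by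
  simp [permExtend]

@[simp]
theorem permExtend_succAbove {N : ℕ} (p q : Fin (N + 1)) (e : Equiv.Perm (Fin N)) (i : Fin N) :
    permExtend p q e (p.succAbove i) = q.succAbove (e i) := by
  simp [permExtend]

theorem map_univ_succAbove {N : ℕ} (z : Fin (N + 1) → ℂ) (q : Fin (N + 1)) :
    univ.val.map z = z q ::ₘ univ.val.map (z ∘ q.succAbove) := by
  rw [Fin.univ_succAbove _ q]
  simp [Finset.map_val, Function.comp_def]

theorem exists_perm_of_map_univ_eq {N : ℕ} {z z' : Fin N → ℂ}
    (h : univ.val.map z = univ.val.map z') : ∃ σ : Equiv.Perm (Fin N), z = z' ∘ σ := by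
  induction N with
  | zero => exact ⟨1, Subsingleton.elim _ _⟩
  | succ N ih =>
    obtain ⟨q, hq⟩ : ∃ q, z' q = z 0 := by
      have : z 0 ∈ univ.val.map z' := h ▸ Multiset.mem_map_of_mem z (mem_univ_val (0 : Fin (N + 1)))
      obtain ⟨q, -, hq⟩ := Multiset.mem_map.1 this
      exact ⟨q, hq⟩
    rw [map_univ_succAbove z 0, map_univ_succAbove z' q, hq, Multiset.cons_inj_right] at h
    obtain ⟨σ, hσ⟩ := ih h
    refine ⟨permExtend 0 q σ, funext fun a => ?_⟩
    rcases Fin.eq_self_or_eq_succAbove 0 a with rfl | ⟨i, rfl⟩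
    · simp [hq]
    · rw [Function.comp_apply, permExtend_succAbove]
      exact congrFun hσ i

theorem symSum_congr_multiset {N : ℕ} (t : ℂ) (f : Fin N → ℂ → ℂ) {z z' : Fin N → ℂ}
    (h : univ.val.map z = univ.val.map z') : symSum t f z = symSum t f z' := by
  obtain ⟨σ, rfl⟩ := exists_perm_of_map_univ_eq h
  exact symSum_comp_perm t f z' σ

theorem sum_perm_eq_sum_image {N : ℕ} (p : Fin (N + 1)) (F : Equiv.Perm (Fin (N + 1)) → ℂ) :
    ∑ w, F w = ∑ q, ∑ e, F (permExtend p q e) := by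
  rw [← Fintype.sum_prod_type']
  symm
  refine Fintype.sum_bijective (fun x : Fin (N + 1) × Equiv.Perm (Fin N) => permExtend p x.1 x.2)
    ?_ _ _ fun _ => rfl
  rw [Fintype.bijective_iff_injective_and_card]
  refine ⟨?_, by simp [Fintype.card_perm, Nat.factorial_succ]⟩
  rintro ⟨q, e⟩ ⟨q', e'⟩ h
  have h' := DFunLike.congr_fun h
  have hq : q = q' := by simpa using h' p
  subst hq
  refine Prod.ext rfl (Equiv.ext fun i => ?_)
  simpa using h' (p.succAbove i)

theorem sum_perm_eq_sum_preimage {N : ℕ} (q : Fin (N + 1)) (F : Equiv.Perm (Fin (N + 1)) → ℂ) :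
    ∑ w, F w = ∑ p, ∑ e, F (permExtend p q e) := by
  rw [← Equiv.sum_comp (Equiv.inv _) F, sum_perm_eq_sum_image q]
  refine sum_congr rfl fun p _ => ?_
  rw [← Equiv.sum_comp (Equiv.inv _)]
  refine sum_congr rfl fun e _ => congrArg F ?_
  refine inv_eq_of_mul_eq_one_right (Equiv.ext fun a => ?_)
  rcases Fin.eq_self_or_eq_succAbove p a with rfl | ⟨i, rfl⟩ <;> simp

theorem prod_Ioi_succAbove {N : ℕ} (k : Fin (N + 1)) (φ : Fin (N + 1) → Fin (N + 1) → ℂ) :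
    ∏ i, ∏ j ∈ Ioi i, φ i j =
      (∏ i : Fin N, if k.succAbove i < k then φ (k.succAbove i) k else φ k (k.succAbove i)) *
        ∏ i, ∏ j ∈ Ioi i, φ (k.succAbove i) (k.succAbove j) := by
  have h : ∀ (n : ℕ) (i : Fin n) (ψ : Fin n → ℂ),
      ∏ j ∈ Ioi i, ψ j = ∏ j, if i < j then ψ j else 1 := by
    intro n i ψ
    rw [← prod_filter]
    congr 1
    ext j
    simp
  simp only [h]
  rw [Fin.prod_univ_succAbove _ k, Fin.prod_univ_succAbove _ k]
  simp only [lt_irrefl, if_false, one_mul]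
  rw [show ∀ a b : ℂ, a * b = b * a from mul_comm]
  rw [prod_congr rfl fun i _ => Fin.prod_univ_succAbove
    (fun j => if k.succAbove i < j then φ (k.succAbove i) j else 1) k]
  rw [prod_mul_distrib, mul_right_comm, ← prod_mul_distrib]
  congr 1
  · refine prod_congr rfl fun i _ => ?_
    rcases lt_or_gt_of_ne (k.succAbove_ne i) with h | h
    · simp [h, h.not_gt]
    · simp [h, h.not_gt]
  · simp [Fin.succAbove_lt_succAbove_iff]

/-- Expansion of the symmetrization according to the value taken by the first variable. -/
theorem symSum_succ {N : ℕ} (t : ℂ) (f : Fin (N + 1) → ℂ → ℂ) (z : Fin (N + 1) → ℂ) :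
    symSum t f z = ∑ q, f 0 (z q) *
      (∏ l, (z q - t * z (q.succAbove l)) / (z q - z (q.succAbove l))) *
        symSum t (fun i => f i.succ) (z ∘ q.succAbove) := by
  unfold symSum
  rw [sum_perm_eq_sum_image 0]
  refine sum_congr rfl fun q _ => ?_
  rw [mul_sum]
  refine sum_congr rfl fun e _ => ?_
  rw [Fin.prod_univ_succAbove _ 0, prod_Ioi_succAbove 0]
  have h0 := permExtend_succAbove (0 : Fin (N + 1)) q e
  simp only [permExtend_self, permExtend_succAbove, Fin.not_lt_zero, if_false,
    Function.comp_apply]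
  rw [Equiv.prod_comp e fun l => (z q - t * z (q.succAbove l)) / (z q - z (q.succAbove l))]
  simp only [Fin.succAbove_zero]
  ring

/-- Expansion of the symmetrization according to the position `k` that receives the value `z q`.
After the factors for `z q` placed first are pulled out, the functions in the positions before `k`
are twisted. -/
theorem symSum_eq_sum_position {N : ℕ} (t : ℂ) (f : Fin (N + 1) → ℂ → ℂ) (z : Fin (N + 1) → ℂ)
    (q : Fin (N + 1)) (hz : ∀ l, z (q.succAbove l) ≠ z q)
    (ht : ∀ l, z q - t * z (q.succAbove l) ≠ 0) :
    symSum t f z = (∏ l, (z q - t * z (q.succAbove l)) / (z q - z (q.succAbove l))) *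
      ∑ k, f k (z q) * symSum t (fun i u => f (k.succAbove i) u *
        if i.castSucc < k then -(u - t * z q) / (z q - t * u) else 1) (z ∘ q.succAbove) := by
  conv_lhs => unfold symSum
  rw [sum_perm_eq_sum_preimage q, mul_sum]
  refine sum_congr rfl fun k _ => ?_
  unfold symSum
  rw [mul_sum, mul_sum]
  refine sum_congr rfl fun e _ => ?_
  rw [Fin.prod_univ_succAbove _ k, prod_Ioi_succAbove k]
  simp only [permExtend_self, permExtend_succAbove, Function.comp_apply,
    Fin.succAbove_lt_iff_castSucc_lt]
  rw [prod_mul_distrib,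
    ← Equiv.prod_comp e fun l => (z q - t * z (q.succAbove l)) / (z q - z (q.succAbove l))]
  have h : ∏ i, (if i.castSucc < k then
        (z (q.succAbove (e i)) - t * z q) / (z (q.succAbove (e i)) - z q) else
        (z q - t * z (q.succAbove (e i))) / (z q - z (q.succAbove (e i)))) =
      (∏ i, (z q - t * z (q.succAbove (e i))) / (z q - z (q.succAbove (e i)))) *
        ∏ i, (if i.castSucc < k then
          -(z (q.succAbove (e i)) - t * z q) / (z q - t * z (q.succAbove (e i))) else 1) := by
    rw [← prod_mul_distrib]
    refine prod_congr rfl fun i _ => ?_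
    split_ifs
    · have h1 := sub_ne_zero.2 (hz (e i))
      have h2 := sub_ne_zero.2 (hz (e i)).symm
      have h3 := ht (e i)
      rw [div_mul_div_comm, div_eq_div_iff h1 (mul_ne_zero h2 h3)]
      ring
    · rw [mul_one]
  rw [h]
  ring

/-- Multilinear expansion when the `i`-th function is `hᵢ(u) (aᵢ + bᵢ x u)`. -/
theorem symSum_mul_affine {N : ℕ} (t : ℂ) (h : Fin N → ℂ → ℂ) (a b : Fin N → ℂ) (x : ℂ)
    (z : Fin N → ℂ) :
    symSum t (fun i u => h i u * (a i + b i * (x * u))) z =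
      ∑ S : Finset (Fin N), x ^ #S *
        symSum t (fun i u => h i u * if i ∈ S then b i * u else a i) z := by
  unfold symSum
  simp only [mul_sum]
  rw [sum_comm]
  refine sum_congr rfl fun w _ => ?_
  simp only [prod_mul_distrib, ← mul_assoc, ← sum_mul]
  congr 1
  simp only [add_comm (a _)]
  rw [Finset.prod_add, ← Finset.powerset_univ, mul_sum]
  refine sum_congr rfl fun S _ => ?_
  rw [show (∏ i, if i ∈ S then b i * z (w i) else a i) =
    (∏ i ∈ S, b i * z (w i)) * ∏ i ∈ univ \ S, a i from ?_]
  · simp only [prod_mul_distrib, prod_const]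
    ring
  · rw [prod_ite]
    congr 1
    · exact prod_congr (by ext; simp) fun _ _ => rfl
    · exact prod_congr (by ext; simp) fun _ _ => rfl

/-! ### The symmetrization of 1 and the straightening of an ascent -/

theorem prod_univ_erase_eq_succAbove {N : ℕ} (q : Fin (N + 1)) (g : Fin (N + 1) → ℂ) :
    ∏ j ∈ univ.erase q, g j = ∏ l, g (q.succAbove l) := by
  have h : (univ.erase q : Finset (Fin (N + 1))) = univ.map (Fin.succAboveEmb q) := by
    ext j
    simp [Fin.exists_succAbove_eq_iff]
  rw [h, prod_map]
  rfl

/-- Lagrange interpolation of `∏ (X - t z_l)` at the nodes `z_l` and `0`, in the leading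
coefficient. -/
theorem sum_prod_sub_mul_div_sub {N : ℕ} {t : ℂ} (ht : t ≠ 1) {z : Fin (N + 1) → ℂ}
    (hz : Function.Injective z) (h0 : ∀ i, z i ≠ 0) :
    ∑ q, ∏ l, (z q - t * z (q.succAbove l)) / (z q - z (q.succAbove l)) = tInt t (N + 1) := by
  have hinj : Function.Injective (Fin.cons 0 z : Fin (N + 2) → ℂ) :=
    Fin.cons_injective_iff.2 ⟨by rintro ⟨i, hi⟩; exact h0 i hi, hz⟩
  let P : Polynomial ℂ := ∏ l, (Polynomial.X - Polynomial.C (t * z l))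
  have hmonic : P.Monic := Polynomial.monic_prod_of_monic _ _ fun _ _ => Polynomial.monic_X_sub_C _
  have hdeg : P.degree = ((N + 1 : ℕ) : WithBot ℕ) := by
    simp only [P, Polynomial.degree_prod, Polynomial.degree_X_sub_C]
    simp
  have key := Lagrange.leadingCoeff_eq_sum (s := univ) (v := (Fin.cons 0 z : Fin (N + 2) → ℂ))
    hinj.injOn (P := P) (by rw [hdeg, card_univ, Fintype.card_fin]; rfl)
  rw [hmonic.leadingCoeff, Fin.sum_univ_succ] at key
  simp only [prod_univ_erase_eq_succAbove, Fin.cons_zero, Fin.cons_succ, Fin.succAbove_zero] at key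
  have hP : ∀ x, P.eval x = ∏ l, (x - t * z l) := by
    intro x
    simp [P, Polynomial.eval_prod]
  have h1 : P.eval 0 / ∏ l, (0 - z l) = t ^ (N + 1) := by
    rw [hP, ← prod_div_distrib]
    rw [prod_congr rfl (g := fun _ => t)]
    · simp
    · intro l _
      have := h0 l
      field_simp
      ring
  have h2 : ∀ q : Fin (N + 1), P.eval (z q) /
      ∏ l, (z q - (Fin.cons 0 z : Fin (N + 2) → ℂ) (q.succ.succAbove l)) =
      (1 - t) * ∏ l, (z q - t * z (q.succAbove l)) / (z q - z (q.succAbove l)) := by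
    intro q
    rw [hP, Fin.prod_univ_succAbove _ q, Fin.prod_univ_succ, prod_div_distrib]
    simp only [Fin.succ_succAbove_zero, Fin.succ_succAbove_succ, Fin.cons_zero, Fin.cons_succ]
    have := h0 q
    rw [mul_div_mul_comm]
    congr 1
    field_simp
    ring
  rw [h1, sum_congr rfl fun q _ => h2 q, ← mul_sum] at key
  rw [tInt, eq_div_iff (sub_ne_zero.2 ht.symm)]
  linear_combination -key

/-- The case `μ = 0`: the symmetrization of `1` is the `t`-factorial. -/
theorem symSum_one {N : ℕ} {t : ℂ} (ht : t ≠ 1) {z : Fin N → ℂ}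
    (hz : Function.Injective z) (h0 : ∀ i, z i ≠ 0) :
    symSum t (fun _ _ => 1) z = tFactorial t N := by
  induction N with
  | zero => simp [symSum, tFactorial]
  | succ N ih =>
    rw [symSum_succ]
    have : ∀ q : Fin (N + 1), symSum t (fun _ _ => 1) (z ∘ q.succAbove) = tFactorial t N :=
      fun q => ih (hz.comp Fin.succAbove_right_injective) fun i => h0 _
    simp only [this, one_mul, ← sum_mul]
    rw [sum_prod_sub_mul_div_sub ht hz h0, tFactorial, tFactorial, prod_range_succ, mul_comm]

/-- The pairs `a < b` other than `(i, i + 1)` are permuted by the transposition of `i` and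
`i + 1`. -/
theorem prod_Ioi_comp_swap_castSucc {N : ℕ} (i : Fin N) :
    ∃ P : Finset (Fin (N + 1) × Fin (N + 1)),
      (∀ φ : Fin (N + 1) → Fin (N + 1) → ℂ, ∏ a, ∏ b ∈ Ioi a, φ a b =
        φ i.castSucc i.succ * ∏ p ∈ P, φ p.1 p.2) ∧
      ∀ φ : Fin (N + 1) → Fin (N + 1) → ℂ, ∏ p ∈ P,
        φ (Equiv.swap i.castSucc i.succ p.1) (Equiv.swap i.castSucc i.succ p.2) =
          ∏ p ∈ P, φ p.1 p.2 := by
  refine ⟨({p | p.1 < p.2} : Finset (Fin (N + 1) × Fin (N + 1))).erase (i.castSucc, i.succ),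
    fun φ => ?_, fun φ => ?_⟩
  · refine Eq.trans ?_ (mul_prod_erase _ (fun p : Fin (N + 1) × Fin (N + 1) => φ p.1 p.2)
      (a := (i.castSucc, i.succ)) (by simp)).symm
    rw [prod_filter, Fintype.prod_prod_type]
    refine prod_congr rfl fun a _ => ?_
    rw [← prod_filter]
    exact prod_congr (by ext; simp) fun _ _ => rfl
  · have hlt : ∀ a b : Fin (N + 1), a < b → (a, b) ≠ (i.castSucc, i.succ) →
        Equiv.swap i.castSucc i.succ a < Equiv.swap i.castSucc i.succ b := by
      intro a b hab hne
      simp only [Equiv.swap_apply_def, Fin.lt_def, Fin.ext_iff, ne_eq, Prod.mk.injEq] at *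
      split_ifs <;> simp at * <;> omega
    refine prod_bij'
      (fun p _ => (Equiv.swap i.castSucc i.succ p.1, Equiv.swap i.castSucc i.succ p.2))
      (fun p _ => (Equiv.swap i.castSucc i.succ p.1, Equiv.swap i.castSucc i.succ p.2)) ?_ ?_ ?_ ?_
      (fun _ _ => rfl)
    all_goals
      rintro ⟨a, b⟩ h
      simp only [mem_erase, mem_filter, mem_univ, true_and] at h
      simp only [mem_erase, mem_filter, mem_univ, true_and, Equiv.swap_apply_self]
    all_goals
      refine ⟨fun he => ?_, hlt a b h.2 h.1⟩
      simp only [Prod.mk.injEq, Equiv.swap_apply_eq_iff, Equiv.swap_apply_left,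
        Equiv.swap_apply_right] at he
      rw [he.1, he.2] at h
      exact absurd h.2 (Fin.castSucc_lt_succ).not_gt

/-- Straightening of an ascent by one: the two sides have the same factors except those of the pair
`i < i + 1`, and the difference of these is antisymmetric under the exchange of the two
variables. -/
theorem symSum_swap_castSucc {N : ℕ} (t : ℂ) (f : Fin (N + 1) → ℂ → ℂ) (i : Fin N)
    (hf : ∀ u, f i.succ u = u * f i.castSucc u) {z : Fin (N + 1) → ℂ}
    (hz : Function.Injective z) :
    symSum t f z = t * symSum t (f ∘ Equiv.swap i.castSucc i.succ) z := by
  obtain ⟨P, hP, hswap⟩ := prod_Ioi_comp_swap_castSucc i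
  set σ : Equiv.Perm (Fin (N + 1)) := Equiv.swap i.castSucc i.succ with hσ
  have hσl : σ i.castSucc = i.succ := Equiv.swap_apply_left _ _
  have hσr : σ i.succ = i.castSucc := Equiv.swap_apply_right _ _
  have hσσ : ∀ a, σ (σ a) = a := fun a => Equiv.swap_apply_self _ _ _
  have hne : ∀ a b : Fin (N + 1), a ≠ b → z a - z b ≠ 0 := fun a b h => sub_ne_zero.2 (hz.ne h)
  let K : Equiv.Perm (Fin (N + 1)) → ℂ := fun w =>
    (∏ p ∈ P, (z (w p.1) - t * z (w p.2)) / (z (w p.1) - z (w p.2))) *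
      ((∏ j ∈ univ.filter (fun j => j ≠ i.castSucc ∧ j ≠ i.succ), f j (z (w j))) *
        (f i.castSucc (z (w i.castSucc)) * f i.castSucc (z (w i.succ))))
  have hprod : ∀ w : Equiv.Perm (Fin (N + 1)), ∏ j, f j (z (w j)) =
      (∏ j ∈ univ.filter (fun j => j ≠ i.castSucc ∧ j ≠ i.succ), f j (z (w j))) *
        (f i.castSucc (z (w i.castSucc)) * f i.succ (z (w i.succ))) := by
    intro w
    rw [← prod_filter_mul_prod_filter_not univ (fun j => j ≠ i.castSucc ∧ j ≠ i.succ)]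
    congr 1
    rw [← prod_pair (f := fun j => f j (z (w j))) (Fin.castSucc_lt_succ (i := i)).ne]
    refine prod_congr ?_ fun _ _ => rfl
    ext j
    simp only [mem_filter, mem_univ, true_and, mem_insert, mem_singleton]
    tauto
  have hKσ : ∀ w, K (w * σ) = K w := by
    intro w
    simp only [K, Equiv.Perm.mul_apply, hσl, hσr]
    rw [hswap fun a b => (z (w a) - t * z (w b)) / (z (w a) - z (w b))]
    rw [prod_congr rfl (g := fun j => f j (z (w j)))]
    · ring
    · intro j hj
      simp only [mem_filter, mem_univ, true_and] at hj
      rw [hσ, Equiv.swap_apply_of_ne_of_ne hj.1 hj.2]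
  have h1 : symSum t f z = ∑ w, K w * (z (w i.succ) *
      ((z (w i.castSucc) - t * z (w i.succ)) / (z (w i.castSucc) - z (w i.succ)))) := by
    unfold symSum
    refine sum_congr rfl fun w _ => ?_
    rw [hP, hprod, hf]
    simp only [K]
    ring
  have h2 : symSum t (f ∘ σ) z = ∑ w, K w * (z (w i.succ) *
      ((z (w i.succ) - t * z (w i.castSucc)) / (z (w i.succ) - z (w i.castSucc)))) := by
    unfold symSum
    rw [← Equiv.sum_comp (Equiv.mulRight σ)]
    refine sum_congr rfl fun w _ => ?_
    rw [← hKσ w]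
    have : ∏ j, (f ∘ σ) j (z ((w * σ) j)) = ∏ j, f j (z (w j)) :=
      Equiv.prod_comp σ fun j => f j (z (w j))
    rw [Equiv.coe_mulRight, this, hP, hprod, hf]
    simp only [hKσ]
    simp only [Equiv.Perm.mul_apply, hσl, hσr]
    rw [hswap fun a b => (z (w a) - t * z (w b)) / (z (w a) - z (w b))]
    simp only [K]
    ring
  rw [h1, h2, mul_sum, ← sub_eq_zero, ← sum_sub_distrib]
  refine self_eq_neg.1 ?_
  conv_lhs => rw [← Equiv.sum_comp (Equiv.mulRight σ)]
  rw [← sum_neg_distrib]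
  refine sum_congr rfl fun w _ => ?_
  simp only [Equiv.coe_mulRight, hKσ, Equiv.Perm.mul_apply, hσl, hσr]
  have ha := hne (w i.castSucc) (w i.succ) (w.injective.ne (Fin.castSucc_lt_succ (i := i)).ne)
  have hb := hne (w i.succ) (w i.castSucc) (w.injective.ne (Fin.castSucc_lt_succ (i := i)).ne')
  field_simp
  ring

/-! ### Integrals over the unit circle -/

open MeasureTheory in
/-- Arc length `dθ` on the unit circle, as a measure on `ℂ`. -/
noncomputable def circMeasure : Measure ℂ :=
  (volume.restrict (Set.Icc 0 (2 * Real.pi))).map fun θ : ℝ => Complex.exp (θ * Complex.I)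

theorem measurable_exp_mul_I : Measurable fun θ : ℝ => Complex.exp (θ * Complex.I) := by
  fun_prop

section CircleMeasure

open MeasureTheory

instance isFiniteMeasure_circMeasure : IsFiniteMeasure circMeasure := by
  unfold circMeasure
  infer_instance

theorem ae_circMeasure_norm : ∀ᵐ x ∂circMeasure, ‖x‖ = 1 := by
  rw [circMeasure, ae_map_iff measurable_exp_mul_I.aemeasurable
    (measurableSet_eq_fun measurable_norm measurable_const)]
  exact .of_forall fun θ => Complex.norm_exp_ofReal_mul_I θ

instance nullSingletonClass_circMeasure : NullSingletonClass circMeasure where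
  measure_singleton x := by
    rw [circMeasure, Measure.map_apply measurable_exp_mul_I (measurableSet_singleton x)]
    refine Measure.restrict_le_self.absolutelyContinuous (Set.Countable.measure_zero ?_ _)
    have h := (Set.countable_singleton x).preimage_circleMap 0 (one_ne_zero (α := ℝ))
    convert h using 2
    ext θ
    simp [circleMap]

theorem integral_circMeasure {f : ℂ → ℂ} (hf : AEStronglyMeasurable f circMeasure) :
    ∫ x, f x ∂circMeasure = ∫ θ in (0 : ℝ)..2 * Real.pi, f (circleMap 0 1 θ) := by
  rw [circMeasure, integral_map measurable_exp_mul_I.aemeasurable hf,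
    integral_Icc_eq_integral_Ioc, intervalIntegral.integral_of_le Real.two_pi_pos.le]
  simp [circleMap]

theorem aestronglyMeasurable_circMeasure {f : ℂ → ℂ} (hf : ContinuousOn f (Metric.sphere 0 1)) :
    AEStronglyMeasurable f circMeasure := by
  have h : circMeasure.restrict (Metric.sphere 0 1) = circMeasure := by
    rw [Measure.restrict_eq_self_of_ae_mem]
    filter_upwards [ae_circMeasure_norm] with x hx
    simpa using hx
  rw [← h]
  exact hf.aestronglyMeasurable Metric.isClosed_sphere.measurableSet

theorem integrable_circMeasure {f : ℂ → ℂ} (hf : ContinuousOn f (Metric.sphere 0 1)) :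
    Integrable f circMeasure := by
  obtain ⟨C, hC⟩ := (isCompact_sphere (0 : ℂ) 1).exists_bound_of_continuousOn hf
  refine Integrable.of_bound (aestronglyMeasurable_circMeasure hf) C ?_
  filter_upwards [ae_circMeasure_norm] with x hx
  exact hC x (by simpa using hx)

theorem integral_circMeasure_inv {f : ℂ → ℂ} (hf : ContinuousOn f (Metric.sphere 0 1)) :
    ∫ x, f x⁻¹ ∂circMeasure = ∫ x, f x ∂circMeasure := by
  have hinv : ContinuousOn (fun x : ℂ => f x⁻¹) (Metric.sphere 0 1) := by
    refine hf.comp (continuousOn_inv₀.mono fun x hx => ?_) fun x hx => ?_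
    · rintro rfl
      simp at hx
    · simpa using hx
  rw [integral_circMeasure (aestronglyMeasurable_circMeasure hinv),
    integral_circMeasure (aestronglyMeasurable_circMeasure hf)]
  have h := intervalIntegral.integral_comp_sub_left (a := 0) (b := 2 * Real.pi)
    (fun θ => f (circleMap 0 1 θ)) (2 * Real.pi)
  rw [sub_self, sub_zero] at h
  rw [← h]
  refine intervalIntegral.integral_congr fun θ _ => ?_
  simp only [circleMap, zero_add, Complex.ofReal_one, one_mul, ← Complex.exp_neg]
  congr 1
  push_cast
  rw [sub_mul, Complex.exp_sub, Complex.exp_two_pi_mul_I, Complex.exp_neg, one_div]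

theorem integral_circMeasure_of_differentiableOn {f : ℂ → ℂ} {R : ℝ} (hR : 1 < R)
    (hf : DifferentiableOn ℂ f (Metric.ball 0 R)) :
    ∫ x, f x ∂circMeasure = 2 * Real.pi * f 0 := by
  have hsub : Metric.closedBall (0 : ℂ) 1 ⊆ Metric.ball 0 R := Metric.closedBall_subset_ball hR
  rw [integral_circMeasure (aestronglyMeasurable_circMeasure
    (hf.continuousOn.mono (Metric.sphere_subset_closedBall.trans hsub)))]
  have h := circleAverage_of_differentiable_on_off_countable (f := f) (c := 0) (R := 1)
    Set.countable_empty (by simpa using hf.continuousOn.mono hsub) (by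
      intro z hz
      refine hf.differentiableAt (Metric.isOpen_ball.mem_nhds (hsub ?_))
      simpa using Metric.ball_subset_closedBall hz.1)
  rw [Real.circleAverage_def, Complex.real_smul] at h
  rw [← h]
  push_cast
  field_simp

/-- The function agrees on the unit circle with a function holomorphic on a disc of radius
greater than `1`. -/
def ExtendsToDisc (F : ℂ → ℂ) : Prop :=
  ∃ R : ℝ, 1 < R ∧ ∃ A : ℂ → ℂ, DifferentiableOn ℂ A (Metric.ball 0 R) ∧ ∀ x, ‖x‖ = 1 → A x = F x

theorem ExtendsToDisc.congr {F G : ℂ → ℂ} (hF : ExtendsToDisc F) (h : ∀ x, ‖x‖ = 1 → F x = G x) :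
    ExtendsToDisc G := by
  obtain ⟨R, hR, A, hA, hAF⟩ := hF
  exact ⟨R, hR, A, hA, fun x hx => (hAF x hx).trans (h x hx)⟩

theorem ExtendsToDisc.of_differentiable {F : ℂ → ℂ} (hF : Differentiable ℂ F) : ExtendsToDisc F :=
  ⟨2, one_lt_two, F, hF.differentiableOn, fun _ _ => rfl⟩

theorem ExtendsToDisc.mul {F G : ℂ → ℂ} (hF : ExtendsToDisc F) (hG : ExtendsToDisc G) :
    ExtendsToDisc fun x => F x * G x := by
  obtain ⟨R, hR, A, hA, hAF⟩ := hF
  obtain ⟨R', hR', A', hA', hAF'⟩ := hG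
  refine ⟨min R R', lt_min hR hR', fun x => A x * A' x, ?_,
    fun x hx => by simp only [hAF x hx, hAF' x hx]⟩
  exact (hA.mono (Metric.ball_subset_ball (min_le_left _ _))).mul
    (hA'.mono (Metric.ball_subset_ball (min_le_right _ _)))

theorem ExtendsToDisc.add {F G : ℂ → ℂ} (hF : ExtendsToDisc F) (hG : ExtendsToDisc G) :
    ExtendsToDisc fun x => F x + G x := by
  obtain ⟨R, hR, A, hA, hAF⟩ := hF
  obtain ⟨R', hR', A', hA', hAF'⟩ := hG
  refine ⟨min R R', lt_min hR hR', fun x => A x + A' x, ?_,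
    fun x hx => by simp only [hAF x hx, hAF' x hx]⟩
  exact (hA.mono (Metric.ball_subset_ball (min_le_left _ _))).add
    (hA'.mono (Metric.ball_subset_ball (min_le_right _ _)))

theorem ExtendsToDisc.sum {ι : Type*} (s : Finset ι) {F : ι → ℂ → ℂ}
    (hF : ∀ i ∈ s, ExtendsToDisc (F i)) : ExtendsToDisc fun x => ∑ i ∈ s, F i x := by
  classical
  induction s using Finset.induction_on with
  | empty => simpa using ExtendsToDisc.of_differentiable (differentiable_const (0 : ℂ))
  | insert a s ha ih =>
    simp only [sum_insert ha]
    exact (hF a (mem_insert_self a s)).add (ih fun i hi => hF i (mem_insert_of_mem hi))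

theorem ExtendsToDisc.prod {ι : Type*} (s : Finset ι) {F : ι → ℂ → ℂ}
    (hF : ∀ i ∈ s, ExtendsToDisc (F i)) : ExtendsToDisc fun x => ∏ i ∈ s, F i x := by
  classical
  induction s using Finset.induction_on with
  | empty => simpa using ExtendsToDisc.of_differentiable (differentiable_const (1 : ℂ))
  | insert a s ha ih =>
    simp only [prod_insert ha]
    exact (hF a (mem_insert_self a s)).mul (ih fun i hi => hF i (mem_insert_of_mem hi))

theorem ExtendsToDisc.inv_one_sub_mul {c : ℂ} (hc : ‖c‖ < 1) (m : ℕ) :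
    ExtendsToDisc fun x => (1 - c * x ^ (m + 1))⁻¹ := by
  obtain ⟨R, hR1, hR⟩ : ∃ R : ℝ, 1 < R ∧ ‖c‖ * R ^ (m + 1) < 1 := by
    have hcont : Filter.Tendsto (fun R : ℝ => ‖c‖ * R ^ (m + 1)) (nhdsWithin 1 (Set.Ioi 1))
        (nhds (‖c‖ * 1 ^ (m + 1))) :=
      ((continuous_const.mul (continuous_pow _)).tendsto 1).mono_left nhdsWithin_le_nhds
    rw [one_pow, mul_one] at hcont
    obtain ⟨R, h1, h2⟩ := ((hcont.eventually (gt_mem_nhds hc)).and self_mem_nhdsWithin).exists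
    exact ⟨R, h2, h1⟩
  refine ⟨R, hR1, _, DifferentiableOn.inv (by fun_prop) fun x hx h => ?_, fun _ _ => rfl⟩
  have h1 : ‖c * x ^ (m + 1)‖ = 1 := by
    rw [← sub_eq_zero.1 h, norm_one]
  rw [norm_mul, norm_pow] at h1
  have hx' : ‖x‖ ≤ R := by simpa using (Metric.mem_ball.1 hx).le
  have := mul_le_mul_of_nonneg_left (pow_le_pow_left₀ (norm_nonneg x) hx' (m + 1)) (norm_nonneg c)
  linarith

/-- `F 1 - F (-1)` is twice the sum of the odd Taylor coefficients of `F`. The proof divides `F` by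
`x ^ 2 - 1`: the quotient contributes nothing to the integral, and the remainder `d + c x`
contributes its coefficient `c`. -/
theorem ExtendsToDisc.integral_sub_inv_div {F : ℂ → ℂ} (hF : ExtendsToDisc F) :
    ∫ x, (F x - F x⁻¹) / (x - x⁻¹) ∂circMeasure = Real.pi * (F 1 - F (-1)) := by
  obtain ⟨R, hR, A, hA, hAF⟩ := hF
  set c := (A 1 - A (-1)) / 2 with hc
  set d := (A 1 + A (-1)) / 2 with hd
  have hball : Metric.ball (0 : ℂ) R ∈ nhds (1 : ℂ) :=
    Metric.isOpen_ball.mem_nhds (by simpa using hR)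
  have hball' : Metric.ball (0 : ℂ) R ∈ nhds (-1 : ℂ) :=
    Metric.isOpen_ball.mem_nhds (by simpa using hR)
  -- `A x = d + c x + (x ^ 2 - 1) H x`
  let P : ℂ → ℂ := fun x => A x - d - c * x
  have hP : DifferentiableOn ℂ P (Metric.ball 0 R) := by
    simp only [P]
    fun_prop
  have hP1 : DifferentiableOn ℂ (dslope P 1) (Metric.ball 0 R) :=
    (Complex.differentiableOn_dslope hball).2 hP
  let H : ℂ → ℂ := dslope (dslope P 1) (-1)
  have hH : DifferentiableOn ℂ H (Metric.ball 0 R) := (Complex.differentiableOn_dslope hball').2 hP1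
  have hA2 : ∀ x, A x = d + c * x + (x ^ 2 - 1) * H x := by
    intro x
    have h1 := sub_smul_dslope P 1 x
    have h2 := sub_smul_dslope (dslope P 1) (-1) x
    have h3 := sub_smul_dslope P 1 (-1)
    have h4 : P 1 = 0 := by simp only [P, hc, hd]; ring
    have h5 : P (-1) = 0 := by simp only [P, hc, hd]; ring
    rw [h4, h5, smul_eq_mul, sub_zero] at h3
    have h6 : dslope P 1 (-1) = 0 := by
      rcases mul_eq_zero.1 h3 with h | h
      · norm_num at h
      · exact h
    rw [h6, smul_eq_mul, sub_zero] at h2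
    rw [h4, smul_eq_mul, sub_zero] at h1
    change _ * H x = _ at h2
    have h7 : P x = A x - d - c * x := rfl
    linear_combination -h7 - h1 - (x - 1) * h2
  have hk : DifferentiableOn ℂ (fun x => x * H x) (Metric.ball 0 R) := by fun_prop
  have hkc : ContinuousOn (fun x => x * H x) (Metric.sphere 0 1) :=
    hk.continuousOn.mono (Metric.sphere_subset_closedBall.trans (Metric.closedBall_subset_ball hR))
  have hk0 : ∫ x, x * H x ∂circMeasure = 0 := by
    rw [integral_circMeasure_of_differentiableOn hR hk]
    simp
  have hki : Integrable (fun x : ℂ => x⁻¹ * H x⁻¹) circMeasure := by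
    refine integrable_circMeasure (f := (fun x => x * H x) ∘ fun x => x⁻¹) (hkc.comp
      (continuousOn_inv₀.mono fun x hx => ?_) fun x hx => ?_)
    · rintro rfl
      simp at hx
    · simpa using hx
  have hae : (fun x => (F x - F x⁻¹) / (x - x⁻¹)) =ᵐ[circMeasure]
      fun x => x * H x + x⁻¹ * H x⁻¹ + c := by
    filter_upwards [ae_circMeasure_norm,
      (measure_eq_zero_iff_ae_notMem.1 (measure_singleton (μ := circMeasure) (1 : ℂ))),
      (measure_eq_zero_iff_ae_notMem.1 (measure_singleton (μ := circMeasure) (-1 : ℂ)))]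
      with x hx h1 h2
    have hx0 : x ≠ 0 := by
      rintro rfl
      simp at hx
    rw [← hAF x hx, ← hAF x⁻¹ (by rw [norm_inv, hx, inv_one]), hA2 x, hA2 x⁻¹]
    have h3 : x - 1 ≠ 0 := sub_ne_zero.2 h1
    have h4 : x + 1 ≠ 0 := fun h => h2 (eq_neg_of_add_eq_zero_left h)
    have h5 : x - x⁻¹ ≠ 0 := by
      intro h
      have : (x - 1) * (x + 1) = x * (x - x⁻¹) := by
        field_simp
        ring
      rw [h, mul_zero] at this
      exact mul_ne_zero h3 h4 this
    rw [div_eq_iff h5]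
    field_simp
    ring
  have hsum : Integrable (fun x : ℂ => x * H x + x⁻¹ * H x⁻¹) circMeasure :=
    (integrable_circMeasure hkc).add hki
  rw [integral_congr_ae hae, integral_add hsum (integrable_const c),
    integral_add (integrable_circMeasure hkc) hki, hk0,
    integral_circMeasure_inv hkc, hk0, integral_circMeasure_of_differentiableOn hR
      (differentiableOn_const c), hc, hAF 1 (by simp), hAF (-1) (by simp)]
  ring

end CircleMeasure

/-! ### Functions that are Lipschitz on the unit circle -/

section UnifLip

open MeasureTheory

variable {Y : Type*} [MeasurableSpace Y]

/-- A measurable function of a point `x` of the unit circle and a parameter `y`, bounded and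
Lipschitz in `x`, uniformly for `y ∈ s`. -/
structure UnifLip (s : Set Y) (a : ℂ → Y → ℂ) : Prop where
  measurable : Measurable fun p : ℂ × Y => a p.1 p.2
  bound : ∃ C : ℝ, ∀ y ∈ s, ∀ x, ‖x‖ = 1 →
    ‖a x y‖ ≤ C ∧ ∀ x', ‖x'‖ = 1 → ‖a x y - a x' y‖ ≤ C * ‖x - x'‖

variable {s : Set Y} {a b : ℂ → Y → ℂ}

theorem UnifLip.of_param {c : Y → ℂ} (hc : Measurable c) {C : ℝ} (hC : ∀ y ∈ s, ‖c y‖ ≤ C) :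
    UnifLip s fun _ y => c y :=
  ⟨hc.comp measurable_snd, max C 0, fun y hy x _ =>
    ⟨(hC y hy).trans (le_max_left _ _), fun x' _ => by
    rw [sub_self, norm_zero]
    positivity⟩⟩

theorem UnifLip.const (c : ℂ) : UnifLip s fun _ _ => c :=
  .of_param measurable_const fun _ _ => le_rfl

theorem UnifLip.id : UnifLip s fun x _ => x :=
  ⟨measurable_fst, 1, fun y _ x hx => ⟨hx.le, fun x' _ => by rw [one_mul]⟩⟩

theorem UnifLip.add (ha : UnifLip s a) (hb : UnifLip s b) : UnifLip s fun x y => a x y + b x y := by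
  obtain ⟨ma, C, hC⟩ := ha
  obtain ⟨mb, D, hD⟩ := hb
  refine ⟨ma.add mb, C + D, fun y hy x hx => ⟨?_, fun x' hx' => ?_⟩⟩
  · exact (norm_add_le _ _).trans (add_le_add (hC y hy x hx).1 (hD y hy x hx).1)
  · rw [add_sub_add_comm, add_mul]
    exact (norm_add_le _ _).trans (add_le_add ((hC y hy x hx).2 x' hx') ((hD y hy x hx).2 x' hx'))

theorem UnifLip.mul (ha : UnifLip s a) (hb : UnifLip s b) : UnifLip s fun x y => a x y * b x y := by
  obtain ⟨ma, C, hC⟩ := ha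
  obtain ⟨mb, D, hD⟩ := hb
  refine ⟨ma.mul mb, max (C * D) (C * D + C * D), fun y hy x hx => ⟨?_, fun x' hx' => ?_⟩⟩
  · rw [norm_mul]
    exact (mul_le_mul (hC y hy x hx).1 (hD y hy x hx).1 (norm_nonneg _)
      ((norm_nonneg _).trans (hC y hy x hx).1)).trans (le_max_left _ _)
  · have h1 := (hC y hy x hx).1
    have h2 := (hD y hy x' hx').1
    have h3 := (hC y hy x hx).2 x' hx'
    have h4 := (hD y hy x hx).2 x' hx'
    calc ‖a x y * b x y - a x' y * b x' y‖
        = ‖a x y * (b x y - b x' y) + (a x y - a x' y) * b x' y‖ := by ring_nf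
      _ ≤ ‖a x y‖ * ‖b x y - b x' y‖ + ‖a x y - a x' y‖ * ‖b x' y‖ := by
        rw [← norm_mul, ← norm_mul]
        exact norm_add_le _ _
      _ ≤ C * (D * ‖x - x'‖) + C * ‖x - x'‖ * D :=
        add_le_add (mul_le_mul h1 h4 (norm_nonneg _) ((norm_nonneg _).trans h1))
          (mul_le_mul h3 h2 (norm_nonneg _) ((norm_nonneg _).trans h3))
      _ = (C * D + C * D) * ‖x - x'‖ := by ring
      _ ≤ _ := mul_le_mul_of_nonneg_right (le_max_right _ _) (norm_nonneg _)

theorem UnifLip.inv (ha : UnifLip s a) {δ : ℝ} (hδ : 0 < δ)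
    (h : ∀ y ∈ s, ∀ x, ‖x‖ = 1 → δ ≤ ‖a x y‖) : UnifLip s fun x y => (a x y)⁻¹ := by
  obtain ⟨ma, C, hC⟩ := ha
  refine ⟨ma.inv, max δ⁻¹ (δ⁻¹ * δ⁻¹ * C), fun y hy x hx => ⟨?_, fun x' hx' => ?_⟩⟩
  · rw [norm_inv]
    exact (inv_anti₀ hδ (h y hy x hx)).trans (le_max_left _ _)
  · have h1 := h y hy x hx
    have h2 := h y hy x' hx'
    have h3 : a x y ≠ 0 := norm_pos_iff.1 (hδ.trans_le h1)
    have h4 : a x' y ≠ 0 := norm_pos_iff.1 (hδ.trans_le h2)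
    rw [inv_sub_inv h3 h4, norm_div, norm_mul, norm_sub_rev, div_eq_inv_mul, mul_inv]
    calc _ ≤ δ⁻¹ * δ⁻¹ * (C * ‖x - x'‖) := by
          gcongr
          exact (hC y hy x hx).2 x' hx'
      _ = (δ⁻¹ * δ⁻¹ * C) * ‖x - x'‖ := by ring
      _ ≤ _ := mul_le_mul_of_nonneg_right (le_max_right _ _) (norm_nonneg _)

theorem UnifLip.comp_inv (ha : UnifLip s a) : UnifLip s fun x y => a x⁻¹ y := by
  obtain ⟨ma, C, hC⟩ := ha
  have hn : ∀ x : ℂ, ‖x‖ = 1 → ‖x⁻¹‖ = 1 := fun x hx => by rw [norm_inv, hx, inv_one]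
  refine ⟨ma.comp (measurable_fst.inv.prodMk measurable_snd), C, fun y hy x hx =>
    ⟨(hC y hy _ (hn x hx)).1, fun x' hx' => ?_⟩⟩
  refine ((hC y hy _ (hn x hx)).2 _ (hn x' hx')).trans_eq ?_
  have h3 : x ≠ 0 := norm_pos_iff.1 (by rw [hx]; exact one_pos)
  have h4 : x' ≠ 0 := norm_pos_iff.1 (by rw [hx']; exact one_pos)
  rw [inv_sub_inv h3 h4, norm_div, norm_mul, hx, hx', norm_sub_rev]
  simp

theorem UnifLip.prod {ι : Type*} (S : Finset ι) {a : ι → ℂ → Y → ℂ}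
    (ha : ∀ i ∈ S, UnifLip s (a i)) : UnifLip s fun x y => ∏ i ∈ S, a i x y := by
  classical
  induction S using Finset.induction_on with
  | empty => simpa using UnifLip.const 1
  | insert i S hi ih =>
    simp only [prod_insert hi]
    exact (ha i (mem_insert_self i S)).mul (ih fun j hj => ha j (mem_insert_of_mem hj))

theorem UnifLip.pow (ha : UnifLip s a) (n : ℕ) : UnifLip s fun x y => a x y ^ n := by
  simpa using UnifLip.prod (range n) (a := fun _ => a) fun _ _ => ha

/-- The Lipschitz bound makes the divided difference bounded, although `x - x⁻¹` vanishes at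
`x = ±1`. -/
theorem UnifLip.integrable {μ : Measure Y} [SigmaFinite μ] (ha : UnifLip s a)
    (hs : ∀ᵐ y ∂μ, y ∈ s) {g : Y → ℂ} (hg : Integrable g μ) :
    Integrable (fun p : ℂ × Y => (a p.1 p.2 - a p.1⁻¹ p.2) / (p.1 - p.1⁻¹) * g p.2)
      (circMeasure.prod μ) := by
  obtain ⟨ma, C, hC⟩ := ha
  have hm : Measurable fun p : ℂ × Y => (a p.1 p.2 - a p.1⁻¹ p.2) / (p.1 - p.1⁻¹) :=
    (ma.sub (ma.comp (measurable_fst.inv.prodMk measurable_snd))).div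
      (measurable_fst.sub measurable_fst.inv)
  refine Integrable.bdd_mul (c := C) (hg.comp_snd circMeasure) hm.aestronglyMeasurable ?_
  have h1 : ∀ᵐ p ∂circMeasure.prod μ, ‖p.1‖ = 1 :=
    Measure.quasiMeasurePreserving_fst.ae ae_circMeasure_norm
  have h2 : ∀ᵐ p ∂circMeasure.prod μ, p.2 ∈ s := Measure.quasiMeasurePreserving_snd.ae hs
  filter_upwards [h1, h2] with p hp1 hp2
  have hn : ‖p.1⁻¹‖ = 1 := by rw [norm_inv, hp1, inv_one]
  have hb := hC p.2 hp2 p.1 hp1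
  rw [norm_div]
  exact div_le_of_le_mul₀ (norm_nonneg _) ((norm_nonneg _).trans hb.1) (hb.2 _ hn)

/-- A measurable function that is Lipschitz on the unit circle. -/
def CircleLip (f : ℂ → ℂ) : Prop :=
  UnifLip (Set.univ : Set Unit) fun x _ => f x

theorem CircleLip.unifLip {f : ℂ → ℂ} (hf : CircleLip f) : UnifLip s fun x _ => f x := by
  obtain ⟨mf, C, hC⟩ := hf
  have h : Measurable f := mf.comp (measurable_id.prodMk (measurable_const (a := ())))
  exact ⟨h.comp measurable_fst, C,
    fun y _ x hx => hC () trivial x hx⟩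

theorem CircleLip.mul {f g : ℂ → ℂ} (hf : CircleLip f) (hg : CircleLip g) :
    CircleLip fun u => f u * g u := UnifLip.mul hf hg

end UnifLip

/-! ### The torus and the alphabet -/

section Generic

open MeasureTheory

/-- Arc length `dθ₁ ⋯ dθₙ` on the torus, as a measure on `ℂⁿ`. -/
noncomputable def torusMeasure (n : ℕ) : Measure (Fin n → ℂ) :=
  Measure.pi fun _ => circMeasure

instance isFiniteMeasure_torusMeasure (n : ℕ) : IsFiniteMeasure (torusMeasure n) := by
  unfold torusMeasure
  infer_instance

/-- A point of the torus at which `x₁^{±1}, …, xₙ^{±1}, 1, -1` are distinct. -/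
structure IsGeneric {n : ℕ} (x : Fin n → ℂ) : Prop where
  norm_eq : ∀ i, ‖x i‖ = 1
  ne_one : ∀ i, x i ≠ 1
  ne_neg_one : ∀ i, x i ≠ -1
  ne : ∀ i j, i ≠ j → x i ≠ x j
  ne_inv : ∀ i j, i ≠ j → x i ≠ (x j)⁻¹

theorem measurePreserving_piFinSuccAbove_torusMeasure {n : ℕ} (j : Fin (n + 1)) :
    MeasurePreserving (MeasurableEquiv.piFinSuccAbove (fun _ => ℂ) j) (torusMeasure (n + 1))
      (circMeasure.prod (torusMeasure n)) :=
  measurePreserving_piFinSuccAbove (fun _ => circMeasure) j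

theorem ae_isGeneric (n : ℕ) : ∀ᵐ x ∂torusMeasure n, IsGeneric x := by
  have h1 : ∀ᵐ x ∂torusMeasure n, ∀ i, ‖x i‖ = 1 :=
    ae_all_iff.2 fun i => (Measure.quasiMeasurePreserving_eval (fun _ => circMeasure) i).ae
      ae_circMeasure_norm
  have h2 : ∀ c : ℂ, ∀ᵐ x ∂torusMeasure n, ∀ i, x i ≠ c := fun c =>
    ae_all_iff.2 fun i => Measure.ae_eval_ne (fun _ => circMeasure) i c
  have h3 : ∀ g : ℂ → ℂ, Measurable g → (∀ x, g (g x) = x) →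
      ∀ᵐ x ∂torusMeasure n, ∀ i j, i ≠ j → x i ≠ g (x j) := by
    intro g hg hgg
    refine ae_all_iff.2 fun i => ae_all_iff.2 fun j => ?_
    by_cases hij : i = j
    · exact .of_forall fun _ h => absurd hij h
    obtain ⟨m, rfl⟩ : ∃ m, n = m + 1 := ⟨n - 1, by have := i.pos; omega⟩
    obtain ⟨l, rfl⟩ := Fin.exists_succAbove_eq (Ne.symm hij)
    have hp : ∀ᵐ p ∂circMeasure.prod (torusMeasure m), p.1 ≠ g (p.2 l) := by
      rw [Measure.ae_prod_iff_ae_ae]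
      · refine .of_forall fun x => ?_
        filter_upwards [Measure.ae_eval_ne (fun _ : Fin m => circMeasure) l (g x)] with y hy h
        exact hy (by rw [h, hgg])
      · exact (measurableSet_eq_fun measurable_fst
          (hg.comp ((measurable_pi_apply l).comp measurable_snd))).compl
    have := (measurePreserving_piFinSuccAbove_torusMeasure i).quasiMeasurePreserving.ae hp
    filter_upwards [this] with x hx _
    exact hx
  filter_upwards [h1, h2 1, h2 (-1), h3 id measurable_id fun _ => rfl,
    h3 (fun x => x⁻¹) measurable_inv inv_inv] with x a b c d e
  exact ⟨a, b, c, d, e⟩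

end Generic

section Alphabet

variable {n : ℕ}

/-- The index of `xᵢ` in the alphabet `pmVars x`. -/
def pmIdx (i : Fin n) : Fin (2 * n) := Fin.cast (two_mul n).symm (Fin.castAdd n i)

/-- The index of `xᵢ⁻¹` in the alphabet `pmVars x`. -/
def pmIdxInv (i : Fin n) : Fin (2 * n) := Fin.cast (two_mul n).symm (Fin.natAdd n i)

@[simp]
theorem pmVars_pmIdx (x : Fin n → ℂ) (i : Fin n) : pmVars x (pmIdx i) = x i :=
  Fin.append_left x (fun i => (x i)⁻¹) i

@[simp]
theorem pmVars_pmIdxInv (x : Fin n → ℂ) (i : Fin n) : pmVars x (pmIdxInv i) = (x i)⁻¹ :=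
  Fin.append_right x (fun i => (x i)⁻¹) i

@[to_additive]
theorem prod_eq_prod_pmIdx {M : Type*} [CommMonoid M] (H : Fin (2 * n) → M) :
    ∏ l, H l = ∏ i, H (pmIdx i) * H (pmIdxInv i) := by
  rw [← Equiv.prod_comp (finCongr (two_mul n).symm), Fin.prod_univ_add, prod_mul_distrib]
  rfl

theorem prod_pmVars (h : ℂ → ℂ) (x : Fin n → ℂ) :
    ∏ l, h (pmVars x l) = ∏ i, h (x i) * h (x i)⁻¹ := by
  simp [prod_eq_prod_pmIdx]

theorem forall_pmVars {p : ℂ → Prop} {x : Fin n → ℂ} (h : ∀ i, p (x i) ∧ p (x i)⁻¹)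
    (l : Fin (2 * n)) : p (pmVars x l) := by
  obtain ⟨l, rfl⟩ := (finCongr (two_mul n).symm).surjective l
  refine Fin.addCases (fun i => ?_) (fun i => ?_) l
  · exact (pmVars_pmIdx x i).symm ▸ (h i).1
  · exact (pmVars_pmIdxInv x i).symm ▸ (h i).2

theorem norm_pmVars {x : Fin n → ℂ} (hx : ∀ i, ‖x i‖ = 1) (l : Fin (2 * n)) : ‖pmVars x l‖ = 1 :=
  forall_pmVars (p := fun u => ‖u‖ = 1) (fun i => ⟨hx i, by rw [norm_inv, hx i, inv_one]⟩) l

theorem map_pmVars (x : Fin n → ℂ) :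
    univ.val.map (pmVars x) = univ.val.map x + univ.val.map fun i => (x i)⁻¹ := by
  have hm : ∀ {m : ℕ} (z : Fin m → ℂ), univ.val.map z = ∑ l, ({z l} : Multiset ℂ) := by
    intro m z
    rw [← Multiset.sum_map_singleton (univ.val.map z), Multiset.map_map]
    rfl
  rw [hm, hm, hm, sum_eq_sum_pmIdx, sum_add_distrib]
  simp

theorem map_pmVars_succAbove (x : Fin (n + 1) → ℂ) (j : Fin (n + 1)) :
    univ.val.map (pmVars x) =
      x j ::ₘ (x j)⁻¹ ::ₘ univ.val.map (pmVars (x ∘ j.succAbove)) := by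
  rw [map_pmVars, map_pmVars, map_univ_succAbove x j, map_univ_succAbove (fun i => (x i)⁻¹) j,
    Multiset.cons_add, Multiset.add_cons]
  rfl

theorem IsGeneric.injective_pmVars {x : Fin n → ℂ} (hx : IsGeneric x) :
    Function.Injective (pmVars x) := by
  have hself : ∀ i, x i ≠ (x i)⁻¹ := by
    intro i h
    have h0 : x i ≠ 0 := norm_pos_iff.1 (by rw [hx.norm_eq]; exact one_pos)
    have h2 : (x i - 1) * (x i + 1) = 0 := by
      have := mul_inv_cancel₀ h0
      rw [← h] at this
      linear_combination this
    rcases mul_eq_zero.1 h2 with h | h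
    · exact hx.ne_one i (sub_eq_zero.1 h)
    · exact hx.ne_neg_one i (eq_neg_of_add_eq_zero_left h)
  have hinj : Function.Injective x := fun i j h => by_contra fun hne => hx.ne i j hne h
  refine Function.Injective.comp ?_ (Fin.cast_injective _)
  rw [Fin.append_injective_iff]
  refine ⟨hinj, fun i j h => hinj (inv_injective h), fun i j h => ?_⟩
  by_cases hij : i = j
  · exact hself j (by rw [← h, hij])
  · exact hx.ne_inv i j hij h

end Alphabet

/-! ### Peeling off one torus variable -/

section Kernel

variable {n : ℕ}

/-- The interaction of two torus variables in the Koornwinder density. -/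
noncomputable def crossFactor (t x y : ℂ) : ℂ :=
  ((1 - x * y) * (1 - x⁻¹ * y⁻¹) * (1 - x⁻¹ * y) * (1 - x * y⁻¹)) /
    ((1 - t * (x * y)) * (1 - t * (x⁻¹ * y⁻¹)) * (1 - t * (x⁻¹ * y)) * (1 - t * (x * y⁻¹)))

/-- The Koornwinder density with parameters `1, -1, √t, -√t`, without its constant `1 / (2ⁿ n!)`. -/
noncomputable def evenDensity (t : ℂ) (x : Fin n → ℂ) : ℂ :=
  (∏ i, ((1 - t * x i ^ 2) * (1 - t * (x i)⁻¹ ^ 2))⁻¹) *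
    ∏ i, ∏ j ∈ Ioi i, crossFactor t (x i) (x j)

theorem crossFactor_comm (t x y : ℂ) : crossFactor t x y = crossFactor t y x := by
  unfold crossFactor
  ring

theorem evenDensity_succAbove (t : ℂ) (x : Fin (n + 1) → ℂ) (j : Fin (n + 1)) :
    evenDensity t x = ((1 - t * x j ^ 2) * (1 - t * (x j)⁻¹ ^ 2))⁻¹ *
      (∏ l, crossFactor t (x j) (x (j.succAbove l))) * evenDensity t (x ∘ j.succAbove) := by
  unfold evenDensity
  rw [Fin.prod_univ_succAbove _ j, prod_Ioi_succAbove j]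
  have h : ∀ l, (if j.succAbove l < j then crossFactor t (x (j.succAbove l)) (x j) else
      crossFactor t (x j) (x (j.succAbove l))) = crossFactor t (x j) (x (j.succAbove l)) := by
    intro l
    rw [crossFactor_comm t (x (j.succAbove l)), ite_self]
  simp only [h, Function.comp_apply]
  ring

/-- The functions left after the first position and position `k + 1` have been taken by `x` and
`x⁻¹`: those between the two positions are twisted by `(t - x u) / (1 - t x u)`. -/
noncomputable def twistTail {N : ℕ} (t x : ℂ) (f : Fin (N + 1) → ℂ → ℂ) (k : Fin (N + 1)) :
    Fin N → ℂ → ℂ :=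
  fun i u => f (k.succAbove i) u * if i.castSucc < k then (t - x * u) / (1 - t * (x * u)) else 1

/-- The part of `symSum f (pmVars (x, y)) * evenDensity (x, y)` in which `x` is in first position is
`peelKernel x y / (x - x⁻¹)`. -/
noncomputable def peelKernel (t : ℂ) (f : Fin (2 * n + 2) → ℂ → ℂ) (x : ℂ) (y : Fin n → ℂ) : ℂ :=
  x * f 0 x / (1 - t * x ^ 2) * ∑ k : Fin (2 * n + 1), f k.succ x⁻¹ *
    (symSum t (twistTail t x (fun i => f i.succ) k) (pmVars y) * evenDensity t y)

theorem one_sub_mul_ne_zero {t : ℂ} (ht : ‖t‖ < 1) {x : ℂ} (hx : ‖x‖ = 1) : 1 - t * x ≠ 0 := by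
  intro h
  have h1 : ‖t * x‖ = 1 := by rw [← sub_eq_zero.1 h, norm_one]
  rw [norm_mul, hx, mul_one] at h1
  exact ht.ne h1

theorem sub_mul_ne_zero {t : ℂ} (ht : ‖t‖ < 1) {v u : ℂ} (hv : ‖v‖ = 1) (hu : ‖u‖ = 1) :
    v - t * u ≠ 0 := by
  intro h
  have h1 : ‖t * u‖ = 1 := by rw [← sub_eq_zero.1 h, hv]
  rw [norm_mul, hu, mul_one] at h1
  exact ht.ne h1

theorem ne_zero_of_norm_eq_one {v : ℂ} (hv : ‖v‖ = 1) : v ≠ 0 :=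
  norm_pos_iff.1 (by rw [hv]; exact one_pos)

/-- Expansion according to the position of the value `v`, with the twist written in terms of
`v⁻¹`. -/
theorem symSum_cons_eq_sum_twistTail {N : ℕ} {t : ℂ} (ht : ‖t‖ < 1) (f : Fin (N + 1) → ℂ → ℂ)
    {v : ℂ} (hv : ‖v‖ = 1) {Z : Fin N → ℂ} (hZ : ∀ l, ‖Z l‖ = 1) (hne : ∀ l, Z l ≠ v) :
    symSum t f (Fin.cons v Z) = (∏ l, (v - t * Z l) / (v - Z l)) *
      ∑ k, f k v * symSum t (twistTail t v⁻¹ f k) Z := by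
  rw [symSum_eq_sum_position t f _ 0 (by simpa using hne)
    (by simpa using fun l => sub_mul_ne_zero ht hv (hZ l))]
  simp only [Fin.cons_zero, Fin.succAbove_zero, Fin.cons_succ]
  congr 1
  refine sum_congr rfl fun k _ => ?_
  congr 1
  refine symSum_congr t fun i j => ?_
  simp only [twistTail, Function.comp_apply, Fin.cons_succ]
  congr 1
  split_ifs
  · have h0 := ne_zero_of_norm_eq_one hv
    rw [div_eq_div_iff (sub_mul_ne_zero ht hv (hZ j)) (one_sub_mul_ne_zero ht (by simp [hv, hZ]))]
    field_simp
    ring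
  · rfl

/-- All factors that involve `v` and the other variables cancel: this is the reason why the
Hall-Littlewood symmetrization can be integrated one variable at a time. -/
theorem prod_mul_prod_mul_prod_crossFactor {t : ℂ} (ht : ‖t‖ < 1) {v : ℂ} (hv : ‖v‖ = 1)
    {y : Fin n → ℂ} (hy : ∀ i, ‖y i‖ = 1) (hne : ∀ i, v ≠ y i ∧ v ≠ (y i)⁻¹) :
    (∏ l, (v - t * pmVars y l) / (v - pmVars y l)) *
      (∏ l, (v⁻¹ - t * pmVars y l) / (v⁻¹ - pmVars y l)) * ∏ i, crossFactor t v (y i) = 1 := by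
  rw [prod_pmVars (fun u => (v - t * u) / (v - u)),
    prod_pmVars (fun u => (v⁻¹ - t * u) / (v⁻¹ - u)),
    ← prod_mul_distrib, ← prod_mul_distrib]
  refine prod_eq_one fun i _ => ?_
  have h0 := ne_zero_of_norm_eq_one hv
  have h1 := ne_zero_of_norm_eq_one (hy i)
  have hv' : ‖v⁻¹‖ = 1 := by rw [norm_inv, hv, inv_one]
  have hy' : ‖(y i)⁻¹‖ = 1 := by rw [norm_inv, hy i, inv_one]
  have e1 : 1 - t * (v * y i) ≠ 0 := one_sub_mul_ne_zero ht (by rw [norm_mul, hv, hy, one_mul])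
  have e2 : 1 - t * (v⁻¹ * (y i)⁻¹) ≠ 0 :=
    one_sub_mul_ne_zero ht (by rw [norm_mul, hv', hy', one_mul])
  have e3 : 1 - t * (v⁻¹ * y i) ≠ 0 := one_sub_mul_ne_zero ht (by rw [norm_mul, hv', hy, one_mul])
  have e4 : 1 - t * (v * (y i)⁻¹) ≠ 0 :=
    one_sub_mul_ne_zero ht (by rw [norm_mul, hv, hy', one_mul])
  have a1 : v - y i ≠ 0 := sub_ne_zero.2 (hne i).1
  have a2 : v - (y i)⁻¹ ≠ 0 := sub_ne_zero.2 (hne i).2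
  have a3 : v⁻¹ - y i ≠ 0 := fun h => (hne i).2 (by rw [← sub_eq_zero.1 h, inv_inv])
  have a4 : v⁻¹ - (y i)⁻¹ ≠ 0 := fun h => (hne i).1 (inv_injective (sub_eq_zero.1 h))
  rw [crossFactor]
  have b1 : v - t * y i = v * (1 - t * (v⁻¹ * y i)) := by field_simp
  have b2 : v - t * (y i)⁻¹ = v * (1 - t * (v⁻¹ * (y i)⁻¹)) := by field_simp
  have b3 : v⁻¹ - t * y i = v⁻¹ * (1 - t * (v * y i)) := by field_simp
  have b4 : v⁻¹ - t * (y i)⁻¹ = v⁻¹ * (1 - t * (v * (y i)⁻¹)) := by field_simp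
  have c1 : 1 - v⁻¹ * y i = v⁻¹ * (v - y i) := by field_simp
  have c2 : 1 - v⁻¹ * (y i)⁻¹ = v⁻¹ * (v - (y i)⁻¹) := by field_simp
  have c3 : 1 - v * y i = v * (v⁻¹ - y i) := by field_simp
  have c4 : 1 - v * (y i)⁻¹ = v * (v⁻¹ - (y i)⁻¹) := by field_simp
  rw [b1, b2, b3, b4, c1, c2, c3, c4]
  generalize v - y i = A1 at *
  generalize v - (y i)⁻¹ = A2 at *
  generalize v⁻¹ - y i = A3 at *
  generalize v⁻¹ - (y i)⁻¹ = A4 at *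
  generalize 1 - t * (v * y i) = E1 at *
  generalize 1 - t * (v⁻¹ * (y i)⁻¹) = E2 at *
  generalize 1 - t * (v⁻¹ * y i) = E3 at *
  generalize 1 - t * (v * (y i)⁻¹) = E4 at *
  field_simp

/-- The contribution of the permutations that put the value `v` first. -/
theorem first_position_mul_evenDensity {t : ℂ} (ht : ‖t‖ < 1) (f : Fin (2 * n + 2) → ℂ → ℂ)
    {v : ℂ} (hv : ‖v‖ = 1) (hv1 : v ≠ 1) (hv2 : v ≠ -1) {y : Fin n → ℂ} (hy : ∀ i, ‖y i‖ = 1)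
    (hne : ∀ i, v ≠ y i ∧ v ≠ (y i)⁻¹) {Z : Fin (2 * n + 1) → ℂ}
    (hZ : univ.val.map Z = v⁻¹ ::ₘ univ.val.map (pmVars y)) :
    f 0 v * (∏ l, (v - t * Z l) / (v - Z l)) * symSum t (fun i => f i.succ) Z *
      (((1 - t * v ^ 2) * (1 - t * v⁻¹ ^ 2))⁻¹ * (∏ i, crossFactor t v (y i)) * evenDensity t y) =
      peelKernel t f v y / (v - v⁻¹) := by
  have hZ' : univ.val.map Z = univ.val.map (Fin.cons v⁻¹ (pmVars y) : Fin (2 * n + 1) → ℂ) := by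
    rw [hZ, map_univ_succAbove (Fin.cons v⁻¹ (pmVars y) : Fin (2 * n + 1) → ℂ) 0]
    rfl
  have hprod : (∏ l, (v - t * Z l) / (v - Z l)) = (v - t * v⁻¹) / (v - v⁻¹) *
      ∏ l, (v - t * pmVars y l) / (v - pmVars y l) := by
    have h := congrArg (fun M => (M.map fun u => (v - t * u) / (v - u)).prod) hZ
    simp only [Multiset.map_cons, Multiset.prod_cons, Multiset.map_map] at h
    exact h
  have hv' : ‖v⁻¹‖ = 1 := by rw [norm_inv, hv, inv_one]
  have hne' : ∀ l, pmVars y l ≠ v⁻¹ := forall_pmVars (p := fun u => u ≠ v⁻¹) fun i =>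
    ⟨fun h => (hne i).2 (by rw [h, inv_inv]), fun h => (hne i).1 (inv_injective h.symm)⟩
  rw [symSum_congr_multiset t _ hZ', hprod,
    symSum_cons_eq_sum_twistTail ht _ hv' (norm_pmVars hy) hne', inv_inv, peelKernel]
  have key := prod_mul_prod_mul_prod_crossFactor ht hv hy hne
  simp only [← mul_assoc, ← sum_mul]
  generalize (∑ k : Fin (2 * n + 1), f k.succ v⁻¹ *
    symSum t (twistTail t v (fun i => f i.succ) k) (pmVars y)) = S
  have h0 := ne_zero_of_norm_eq_one hv
  have e1 : 1 - t * v ^ 2 ≠ 0 := one_sub_mul_ne_zero ht (by rw [norm_pow, hv, one_pow])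
  have e2 : 1 - t * v⁻¹ ^ 2 ≠ 0 := one_sub_mul_ne_zero ht (by rw [norm_pow, hv', one_pow])
  have b1 : v - t * v⁻¹ = v * (1 - t * v⁻¹ ^ 2) := by field_simp
  have hvv : v - v⁻¹ ≠ 0 := by
    intro h
    have h3 : (v - 1) * (v + 1) = v * (v - v⁻¹) := by
      field_simp
      ring
    rw [h, mul_zero] at h3
    rcases mul_eq_zero.1 h3 with h | h
    · exact hv1 (sub_eq_zero.1 h)
    · exact hv2 (eq_neg_of_add_eq_zero_left h)
  rw [b1]
  generalize (∏ l, (v - t * pmVars y l) / (v - pmVars y l)) = P1 at *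
  generalize (∏ l, (v⁻¹ - t * pmVars y l) / (v⁻¹ - pmVars y l)) = P2 at *
  generalize ∏ i, crossFactor t v (y i) = P3 at *
  generalize v - v⁻¹ = V at *
  generalize 1 - t * v ^ 2 = E1 at *
  generalize 1 - t * v⁻¹ ^ 2 = E2 at *
  generalize evenDensity t y = D
  field_simp
  linear_combination (f 0 v * S * D) * key

theorem crossFactor_inv_left (t x y : ℂ) : crossFactor t x⁻¹ y = crossFactor t x y := by
  unfold crossFactor
  rw [inv_inv]
  ring

/-- The terms of the expansion of `symSum` in which `x j` comes first combine with those in which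
`(x j)⁻¹` comes first to a divided difference. -/
theorem symSum_mul_evenDensity_eq_sum {t : ℂ} (ht : ‖t‖ < 1) (f : Fin (2 * n + 2) → ℂ → ℂ)
    {x : Fin (n + 1) → ℂ} (hx : IsGeneric x) :
    symSum t f (pmVars x) * evenDensity t x = ∑ j,
      (peelKernel t f (x j) (x ∘ j.succAbove) - peelKernel t f (x j)⁻¹ (x ∘ j.succAbove)) /
        (x j - (x j)⁻¹) := by
  have hs : symSum t f (pmVars x) = _ :=
    (symSum_succ t f (pmVars x)).trans (sum_eq_sum_pmIdx (n := n + 1) _)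
  rw [hs, sum_mul]
  refine sum_congr rfl fun j _ => ?_
  simp only [pmVars_pmIdx, pmVars_pmIdxInv]
  have hmap := map_pmVars_succAbove x j
  have hmap1 := (map_univ_succAbove (pmVars x) (pmIdx j)).symm.trans hmap
  have hmap2 := ((map_univ_succAbove (pmVars x) (pmIdxInv j)).symm.trans hmap).trans
    (Multiset.cons_swap _ _ _)
  rw [pmVars_pmIdx, Multiset.cons_inj_right] at hmap1
  rw [pmVars_pmIdxInv, Multiset.cons_inj_right] at hmap2
  have hn := hx.norm_eq j
  have hn' : ‖(x j)⁻¹‖ = 1 := by rw [norm_inv, hn, inv_one]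
  have hy : ∀ i, ‖(x ∘ j.succAbove) i‖ = 1 := fun i => hx.norm_eq _
  have h1 := first_position_mul_evenDensity ht f hn (hx.ne_one j) (hx.ne_neg_one j) hy
    (fun i => ⟨hx.ne _ _ (j.succAbove_ne i).symm, hx.ne_inv _ _ (j.succAbove_ne i).symm⟩)
    hmap1
  have h2 := first_position_mul_evenDensity ht f hn'
    (fun h => hx.ne_one j (by rw [← inv_inv (x j), h, inv_one]))
    (fun h => hx.ne_neg_one j (by rw [← inv_inv (x j), h, inv_neg, inv_one])) hy
    (fun i => ⟨fun h => hx.ne_inv _ _ (j.succAbove_ne i).symm (by rw [← inv_inv (x j), h]; rfl),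
      fun h => hx.ne _ _ (j.succAbove_ne i).symm (inv_injective h)⟩)
    (by rw [inv_inv]; exact hmap2)
  rw [evenDensity_succAbove t x j, sub_div, add_mul]
  simp only [crossFactor_inv_left, inv_inv] at h2
  rw [mul_comm (1 - t * (x j)⁻¹ ^ 2)] at h2
  rw [← neg_sub (x j) (x j)⁻¹, div_neg] at h2
  rw [sub_eq_add_neg]
  exact congrArg₂ (· + ·) h1 h2

end Kernel

/-! ### Telescoping sums over signs, and integrability -/

section Telescoping

/-- Replacing the factors `P` by `Q` one after the other, with the `k`-th term the change made at
position `k`. -/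
theorem sum_mul_prod_ite_telescope {N : ℕ} (P Q : Fin (N + 1) → ℂ) :
    ∑ k, (P k - Q k) * ∏ i : Fin N, (if i.castSucc < k then Q (k.succAbove i) else
      P (k.succAbove i)) = ∏ i, P i - ∏ i, Q i := by
  induction N with
  | zero => simp
  | succ N ih =>
    rw [Fin.sum_univ_succ, Fin.prod_univ_succ P, Fin.prod_univ_succ Q]
    have h : ∀ k : Fin (N + 1), (P k.succ - Q k.succ) * ∏ i : Fin (N + 1),
        (if i.castSucc < k.succ then Q (k.succ.succAbove i) else P (k.succ.succAbove i)) =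
        Q 0 * ((P k.succ - Q k.succ) * ∏ i : Fin N, (if i.castSucc < k then
          Q (k.succAbove i).succ else P (k.succAbove i).succ)) := by
      intro k
      rw [Fin.prod_univ_succ]
      simp only [Fin.castSucc_zero, Fin.succ_pos, if_true, Fin.succ_succAbove_zero,
        Fin.succ_succAbove_succ, Fin.castSucc_succ, Fin.succ_lt_succ_iff]
      ring
    simp only [h, ← mul_sum]
    rw [ih (fun i => P i.succ) fun i => Q i.succ]
    simp only [Fin.not_lt_zero, if_false, Fin.succAbove_zero]
    ring

/-- `∏ (fᵢ(1) + s fᵢ(-1))`. -/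
def signProd {N : ℕ} (s : ℂ) (f : Fin N → ℂ → ℂ) : ℂ :=
  ∏ i, (f i 1 + s * f i (-1))

variable {N : ℕ} {t : ℂ}

/-- At `x = 1` the twist is `-1` at the point `1` and `1` at the point `-1`. -/
theorem sum_mul_signProd_twistTail_one (ht : ‖t‖ < 1) (s : ℂ) (g : Fin (N + 1) → ℂ → ℂ) :
    ∑ k, g k 1 * signProd s (twistTail t 1 g k) =
      (signProd s g - (-1) ^ (N + 1) * signProd (-s) g) / 2 := by
  have h1 : (t - 1) / (1 - t) = -1 := by
    rw [div_eq_iff (by simpa using one_sub_mul_ne_zero ht norm_one)]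
    ring
  have h2 : (t + 1) / (1 + t) = 1 := by
    rw [add_comm, div_self (by simpa using one_sub_mul_ne_zero ht (x := -1) (by simp))]
  have h := sum_mul_prod_ite_telescope (fun i => g i 1 + s * g i (-1))
    fun i => -g i 1 + s * g i (-1)
  have h3 : ∏ i, (-g i 1 + s * g i (-1)) = (-1) ^ (N + 1) * signProd (-s) g := by
    rw [signProd, ← Fin.prod_const, ← prod_mul_distrib]
    exact prod_congr rfl fun i _ => by ring
  rw [h3] at h
  rw [signProd, ← h, sum_div]
  refine sum_congr rfl fun k _ => ?_
  have h4 : signProd s (twistTail t 1 g k) = ∏ i : Fin N, (if i.castSucc < k then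
      -g (k.succAbove i) 1 + s * g (k.succAbove i) (-1) else
      g (k.succAbove i) 1 + s * g (k.succAbove i) (-1)) := by
    refine prod_congr rfl fun i _ => ?_
    simp only [twistTail]
    split_ifs
    · simp only [mul_one, mul_neg, sub_neg_eq_add, h1, h2]
    · simp only [mul_one]
  rw [h4]
  ring

/-- At `x = -1` the twist is `1` at the point `1` and `-1` at the point `-1`. -/
theorem sum_mul_signProd_twistTail_neg_one (ht : ‖t‖ < 1) (s : ℂ) (g : Fin (N + 1) → ℂ → ℂ) :
    s * ∑ k, g k (-1) * signProd s (twistTail t (-1) g k) =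
      (signProd s g - signProd (-s) g) / 2 := by
  have h1 : (t - 1) / (1 - t) = -1 := by
    rw [div_eq_iff (by simpa using one_sub_mul_ne_zero ht norm_one)]
    ring
  have h2 : (t + 1) / (1 + t) = 1 := by
    rw [add_comm, div_self (by simpa using one_sub_mul_ne_zero ht (x := -1) (by simp))]
  have h := sum_mul_prod_ite_telescope (fun i => g i 1 + s * g i (-1))
    fun i => g i 1 + -s * g i (-1)
  rw [signProd, signProd, ← h, sum_div, mul_sum]
  refine sum_congr rfl fun k _ => ?_
  have h4 : signProd s (twistTail t (-1) g k) = ∏ i : Fin N, (if i.castSucc < k then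
      g (k.succAbove i) 1 + -s * g (k.succAbove i) (-1) else
      g (k.succAbove i) 1 + s * g (k.succAbove i) (-1)) := by
    refine prod_congr rfl fun i _ => ?_
    simp only [twistTail]
    split_ifs
    · simp only [mul_one, mul_neg, neg_mul, sub_neg_eq_add, neg_neg, h2]
      simp only [← sub_eq_add_neg, h1]
      ring
    · simp only [mul_one]
  rw [h4]
  ring

/-- `∏ (fᵢ(1) + fᵢ(-1)) + ∏ (fᵢ(1) - fᵢ(-1))`, twice the sum over the choices of signs with an even
number of `-1`. -/
def evenSum (f : Fin N → ℂ → ℂ) : ℂ := signProd 1 f + signProd (-1) f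

/-- `∏ (fᵢ(1) + fᵢ(-1)) - ∏ (fᵢ(1) - fᵢ(-1))`, twice the sum over the choices of signs with an odd
number of `-1`. -/
def oddSum (f : Fin N → ℂ → ℂ) : ℂ := signProd 1 f - signProd (-1) f

theorem sum_mul_evenSum_twistTail_one (ht : ‖t‖ < 1) (hN : Even N) (g : Fin (N + 1) → ℂ → ℂ) :
    ∑ k, g k 1 * evenSum (twistTail t 1 g k) = evenSum g := by
  simp only [evenSum, mul_add, sum_add_distrib]
  rw [sum_mul_signProd_twistTail_one ht, sum_mul_signProd_twistTail_one ht,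
    hN.add_one.neg_one_pow, neg_neg]
  ring

theorem sum_mul_oddSum_twistTail_one (ht : ‖t‖ < 1) (hN : Odd N) (g : Fin (N + 1) → ℂ → ℂ) :
    ∑ k, g k 1 * oddSum (twistTail t 1 g k) = oddSum g := by
  simp only [oddSum, mul_sub, sum_sub_distrib]
  rw [sum_mul_signProd_twistTail_one ht, sum_mul_signProd_twistTail_one ht,
    hN.add_one.neg_one_pow, neg_neg]
  ring

theorem sum_mul_evenSum_twistTail_neg_one (ht : ‖t‖ < 1) (g : Fin (N + 1) → ℂ → ℂ) :
    ∑ k, g k (-1) * evenSum (twistTail t (-1) g k) = oddSum g := by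
  simp only [evenSum, oddSum, mul_add, sum_add_distrib]
  have h1 := sum_mul_signProd_twistTail_neg_one ht 1 g
  have h2 := sum_mul_signProd_twistTail_neg_one ht (-1) g
  rw [neg_neg] at h2
  linear_combination h1 - h2

theorem evenSum_succ (f : Fin (N + 1) → ℂ → ℂ) :
    evenSum f = f 0 1 * evenSum (fun i => f i.succ) + f 0 (-1) * oddSum fun i => f i.succ := by
  simp only [evenSum, oddSum, signProd, Fin.prod_univ_succ]
  ring

end Telescoping

section Integrability

open MeasureTheory

variable {n : ℕ} {t : ℂ}

theorem measurable_pmVars_apply (l : Fin (2 * n)) : Measurable fun y : Fin n → ℂ => pmVars y l := by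
  obtain ⟨l, rfl⟩ := (finCongr (two_mul n).symm).surjective l
  refine Fin.addCases (fun i => ?_) (fun i => ?_) l
  · have h : (fun y : Fin n → ℂ => pmVars y (pmIdx i)) = fun y => y i :=
      funext fun y => pmVars_pmIdx y i
    exact h ▸ measurable_pi_apply i
  · have h : (fun y : Fin n → ℂ => pmVars y (pmIdxInv i)) = fun y => (y i)⁻¹ :=
      funext fun y => pmVars_pmIdxInv y i
    exact h ▸ (measurable_pi_apply i).inv

theorem UnifLip.inv_one_sub_mul {Y : Type*} [MeasurableSpace Y] {s : Set Y} {a : ℂ → Y → ℂ}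
    (ht : ‖t‖ < 1) (ha : UnifLip s a) (h1 : ∀ y ∈ s, ∀ x, ‖x‖ = 1 → ‖a x y‖ = 1) :
    UnifLip s fun x y => (1 - t * a x y)⁻¹ := by
  have h : UnifLip s fun x y => 1 + -t * a x y := (UnifLip.const 1).add ((UnifLip.const _).mul ha)
  refine UnifLip.inv (δ := 1 - ‖t‖) ?_ (sub_pos.2 ht) fun y hy x hx => ?_
  · simpa [sub_eq_add_neg] using h
  · have := norm_sub_norm_le 1 (t * a x y)
    rwa [norm_mul, h1 y hy x hx, mul_one, norm_one] at this

/-- The divided difference of the peeling kernel, which is what remains to be integrated. -/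
noncomputable def peelQuotient (t : ℂ) (f : Fin (2 * n + 2) → ℂ → ℂ) (p : ℂ × (Fin n → ℂ)) : ℂ :=
  (peelKernel t f p.1 p.2 - peelKernel t f p.1⁻¹ p.2) / (p.1 - p.1⁻¹)

theorem ae_torusMeasure_norm (n : ℕ) : ∀ᵐ y ∂torusMeasure n, y ∈ {y | ∀ i, ‖y i‖ = 1} :=
  (ae_isGeneric n).mono fun _ h => h.norm_eq

/-- The kernel is a finite sum of products of a function that is Lipschitz in `x` and of a function
of `y` of the same shape as the integrand in fewer variables. -/
theorem integrable_peelQuotient (ht : ‖t‖ < 1) {f : Fin (2 * n + 2) → ℂ → ℂ}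
    (hf : ∀ i, CircleLip (f i))
    (ih : ∀ g : Fin (2 * n) → ℂ → ℂ, (∀ i, CircleLip (g i)) →
      Integrable (fun y => symSum t g (pmVars y) * evenDensity t y) (torusMeasure n)) :
    Integrable (peelQuotient t f) (circMeasure.prod (torusMeasure n)) := by
  set T : Set (Fin n → ℂ) := {y | ∀ i, ‖y i‖ = 1} with hT
  let α : Fin (2 * n + 1) → Fin (2 * n) → ℂ := fun k i => if i.castSucc < k then t else 1
  let β : Fin (2 * n + 1) → Fin (2 * n) → ℂ := fun k i => if i.castSucc < k then -1 else -t
  let h : Fin (2 * n + 1) → Finset (Fin (2 * n)) → Fin (2 * n) → ℂ → ℂ := fun k S i u =>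
    f (k.succAbove i).succ u * if i ∈ S then β k i * u else α k i
  let a : Fin (2 * n + 1) → Finset (Fin (2 * n)) → ℂ → (Fin n → ℂ) → ℂ := fun k S x y =>
    x * f 0 x * (1 - t * x ^ 2)⁻¹ * f k.succ x⁻¹ * (∏ l, (1 - t * (x * pmVars y l))⁻¹) * x ^ #S
  let b : Fin (2 * n + 1) → Finset (Fin (2 * n)) → (Fin n → ℂ) → ℂ := fun k S y =>
    symSum t (h k S) (pmVars y) * evenDensity t y
  have hpeel : ∀ x, ‖x‖ = 1 → ∀ y ∈ T, peelKernel t f x y = ∑ k, ∑ S, a k S x y * b k S y := by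
    intro x hx y hy
    rw [peelKernel, mul_sum]
    refine sum_congr rfl fun k _ => ?_
    have h1 : symSum t (twistTail t x (fun i => f i.succ) k) (pmVars y) =
        (∏ l, (1 - t * (x * pmVars y l))⁻¹) * ∑ S : Finset (Fin (2 * n)), x ^ #S *
          symSum t (h k S) (pmVars y) := by
      rw [← symSum_mul_affine, ← symSum_mul_common t _ fun u => (1 - t * (x * u))⁻¹]
      refine symSum_congr t fun i j => ?_
      have hne : 1 - t * (x * pmVars y j) ≠ 0 :=
        one_sub_mul_ne_zero ht (by rw [norm_mul, hx, norm_pmVars hy, one_mul])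
      simp only [twistTail, α, β]
      split_ifs
      · rw [div_eq_mul_inv]
        ring
      · rw [show (1 : ℂ) + -t * (x * pmVars y j) = 1 - t * (x * pmVars y j) by ring, mul_assoc,
          mul_inv_cancel₀ hne]
    rw [h1, mul_sum, sum_mul, mul_sum, mul_sum]
    refine sum_congr rfl fun S _ => ?_
    simp only [a, b]
    ring
  have ha : ∀ k S, UnifLip T (a k S) := by
    intro k S
    refine ((((UnifLip.id.mul (hf 0).unifLip).mul ?_).mul (hf k.succ).unifLip.comp_inv).mul
      ?_).mul (UnifLip.id.pow _)
    · exact (UnifLip.id.pow 2).inv_one_sub_mul ht fun y _ x hx => by rw [norm_pow, hx, one_pow]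
    · refine UnifLip.prod univ fun l _ =>
        UnifLip.inv_one_sub_mul ht (a := fun x y => x * pmVars y l)
        (UnifLip.id.mul (UnifLip.of_param (measurable_pmVars_apply l) (C := 1)
          fun y hy => (norm_pmVars hy l).le))
        fun y hy x hx => by rw [norm_mul, hx, norm_pmVars hy, one_mul]
  have hlip : ∀ k S i, CircleLip (h k S i) := by
    intro k S i
    refine (hf _).mul ?_
    split_ifs
    · exact (UnifLip.const _).mul UnifLip.id
    · exact UnifLip.const _
  have hint : Integrable (fun p : ℂ × (Fin n → ℂ) => ∑ k, ∑ S,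
      (a k S p.1 p.2 - a k S p.1⁻¹ p.2) / (p.1 - p.1⁻¹) * b k S p.2)
      (circMeasure.prod (torusMeasure n)) :=
    integrable_finsetSum _ fun k _ => integrable_finsetSum _ fun S _ =>
      (ha k S).integrable (ae_torusMeasure_norm n) (ih _ (hlip k S))
  refine hint.congr ?_
  have h1 : ∀ᵐ p ∂circMeasure.prod (torusMeasure n), ‖p.1‖ = 1 :=
    Measure.quasiMeasurePreserving_fst.ae ae_circMeasure_norm
  have h2 : ∀ᵐ p ∂circMeasure.prod (torusMeasure n), p.2 ∈ T :=
    Measure.quasiMeasurePreserving_snd.ae (ae_torusMeasure_norm n)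
  filter_upwards [h1, h2] with p hp1 hp2
  rw [peelQuotient, hpeel _ hp1 _ hp2, hpeel _ (by rw [norm_inv, hp1, inv_one]) _ hp2,
    ← sum_sub_distrib, sum_div]
  refine sum_congr rfl fun k _ => ?_
  rw [← sum_sub_distrib, sum_div]
  refine sum_congr rfl fun S _ => ?_
  ring

theorem ae_symSum_mul_evenDensity_eq_sum (ht : ‖t‖ < 1) (f : Fin (2 * n + 2) → ℂ → ℂ) :
    (fun x : Fin (n + 1) → ℂ => symSum t f (pmVars x) * evenDensity t x) =ᵐ[torusMeasure (n + 1)]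
      fun x => ∑ j, peelQuotient t f (MeasurableEquiv.piFinSuccAbove (fun _ => ℂ) j x) :=
  (ae_isGeneric (n + 1)).mono fun _ hx => symSum_mul_evenDensity_eq_sum ht f hx

theorem integrable_symSum_mul_evenDensity (ht : ‖t‖ < 1) {f : Fin (2 * n) → ℂ → ℂ}
    (hf : ∀ i, CircleLip (f i)) :
    Integrable (fun x => symSum t f (pmVars x) * evenDensity t x) (torusMeasure n) := by
  induction n with
  | zero =>
    have h : (fun x : Fin 0 → ℂ => symSum t f (pmVars x) * evenDensity t x) =
        fun _ => symSum t f (pmVars 0) * evenDensity t (0 : Fin 0 → ℂ) :=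
      funext fun x => by rw [Subsingleton.elim x 0]
    rw [h]
    exact integrable_const _
  | succ n ih =>
    refine Integrable.congr ?_ (ae_symSum_mul_evenDensity_eq_sum ht f).symm
    exact integrable_finsetSum _ fun j _ =>
      (measurePreserving_piFinSuccAbove_torusMeasure j).integrable_comp_of_integrable
        (integrable_peelQuotient ht hf fun g hg => ih hg)

end Integrability

/-! ### The integral over the even component -/

section Evaluation

open MeasureTheory

variable {n N : ℕ} {t : ℂ}

/-- The functions for which the variables can be integrated one at a time: for `i < j`, the function
`x fᵢ(x) fⱼ(x⁻¹)` is holomorphic in the disc. For the monomials `fᵢ(x) = x ^ μᵢ` this holds when the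
exponents `μᵢ` are weakly decreasing. -/
structure IsAdmissible (f : Fin N → ℂ → ℂ) : Prop where
  lip : ∀ i, CircleLip (f i)
  extends_mul : ∀ i j, i < j → ExtendsToDisc fun x => x * (f i x * f j x⁻¹)

theorem ExtendsToDisc.twist (ht : ‖t‖ < 1) {u : ℂ} (hu : ‖u‖ = 1) :
    ExtendsToDisc fun x => (t - x * u) / (1 - t * (x * u)) := by
  have h1 : ExtendsToDisc fun x => t - x * u := .of_differentiable (by fun_prop)
  have h2 := ExtendsToDisc.inv_one_sub_mul (c := t * u) (by rwa [norm_mul, hu, mul_one]) 0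
  refine (h1.mul h2).congr fun x _ => ?_
  rw [div_eq_mul_inv, zero_add, pow_one, mul_assoc t u, mul_comm u]

theorem CircleLip.twist (ht : ‖t‖ < 1) {u : ℂ} (hu : ‖u‖ = 1) :
    CircleLip fun x => (t - u * x) / (1 - t * (u * x)) := by
  have h1 : UnifLip (Set.univ : Set Unit) fun x _ => t + -u * x :=
    (UnifLip.const t).add ((UnifLip.const _).mul UnifLip.id)
  have h2 := ((UnifLip.const (s := (Set.univ : Set Unit)) u).mul UnifLip.id).inv_one_sub_mul ht
    fun y _ x hx => by rw [norm_mul, hx, hu, one_mul]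
  have h := h1.mul h2
  simp only [neg_mul, ← sub_eq_add_neg, ← div_eq_mul_inv] at h
  exact h

theorem IsAdmissible.comp {M : ℕ} {f : Fin N → ℂ → ℂ} (hf : IsAdmissible f) {g : Fin M → Fin N}
    (hg : StrictMono g) : IsAdmissible fun i => f (g i) :=
  ⟨fun _ => hf.lip _, fun _ _ h => hf.extends_mul _ _ (hg h)⟩

theorem IsAdmissible.twistTail (ht : ‖t‖ < 1) {f : Fin (N + 1) → ℂ → ℂ} (hf : IsAdmissible f)
    {ε : ℂ} (hε : ε * ε = 1) (k : Fin (N + 1)) : IsAdmissible (twistTail t ε f k) := by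
  have hε1 : ‖ε‖ = 1 := by
    have h : ‖ε‖ * ‖ε‖ = 1 := by rw [← norm_mul, hε, norm_one]
    nlinarith [norm_nonneg ε]
  refine ⟨fun i => ?_, fun i j hij => ?_⟩
  · refine (hf.lip _).mul ?_
    split_ifs
    · exact .twist ht hε1
    · exact UnifLip.const 1
  · have h := hf.extends_mul _ _ (Fin.strictMono_succAbove k hij)
    simp only [_root_.twistTail]
    by_cases hj : j.castSucc < k
    · -- the two twists are inverse to each other
      have hi : i.castSucc < k := lt_trans (Fin.castSucc_lt_castSucc_iff.2 hij) hj
      refine h.congr fun x hx => ?_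
      have hx' : ‖x⁻¹‖ = 1 := by rw [norm_inv, hx, inv_one]
      have e1 : 1 - t * (ε * x) ≠ 0 := one_sub_mul_ne_zero ht (by rw [norm_mul, hx, hε1, one_mul])
      have e2 : 1 - t * (ε * x⁻¹) ≠ 0 :=
        one_sub_mul_ne_zero ht (by rw [norm_mul, hx', hε1, one_mul])
      have h0 := ne_zero_of_norm_eq_one hx
      have key : (t - ε * x) / (1 - t * (ε * x)) * ((t - ε * x⁻¹) / (1 - t * (ε * x⁻¹))) = 1 := by
        rw [div_mul_div_comm, div_eq_one_iff_eq (mul_ne_zero e1 e2)]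
        field_simp
        linear_combination (1 - t ^ 2) * x * hε
      rw [if_pos hi, if_pos hj]
      linear_combination (-x * (f (k.succAbove i) x * f (k.succAbove j) x⁻¹)) * key
    · simp only [if_neg hj, mul_one]
      by_cases hi : i.castSucc < k
      · have h2 := h.mul (ExtendsToDisc.twist ht hε1)
        refine h2.congr fun x _ => ?_
        rw [if_pos hi, mul_comm x ε]
        ring
      · simpa only [if_neg hi, mul_one] using h

theorem IsAdmissible.extendsToDisc_peelKernel (ht : ‖t‖ < 1) {f : Fin (2 * n + 2) → ℂ → ℂ}
    (hf : IsAdmissible f) {y : Fin n → ℂ} (hy : ∀ i, ‖y i‖ = 1) :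
    ExtendsToDisc fun x => peelKernel t f x y := by
  simp only [peelKernel, mul_sum]
  refine ExtendsToDisc.sum _ fun k _ => ?_
  have h1 := hf.extends_mul 0 k.succ (Fin.succ_pos k)
  have h2 := ExtendsToDisc.inv_one_sub_mul ht 1
  have h3 : ExtendsToDisc fun x =>
      symSum t (_root_.twistTail t x (fun i => f i.succ) k) (pmVars y) := by
    unfold symSum _root_.twistTail
    refine ExtendsToDisc.sum _ fun w _ => ExtendsToDisc.mul (ExtendsToDisc.prod _ fun i _ => ?_)
      (.of_differentiable (differentiable_const _))
    refine ExtendsToDisc.mul (.of_differentiable (differentiable_const _)) ?_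
    split_ifs
    · exact .twist ht (norm_pmVars hy _)
    · exact .of_differentiable (differentiable_const _)
  have h4 : ExtendsToDisc fun _ => evenDensity t y := .of_differentiable (differentiable_const _)
  refine (((h1.mul h2).mul h3).mul h4).congr fun x _ => ?_
  rw [div_eq_mul_inv]
  ring

theorem peelKernel_of_mul_self (f : Fin (2 * n + 2) → ℂ → ℂ) {ε : ℂ} (hε : ε * ε = 1)
    (y : Fin n → ℂ) :
    peelKernel t f ε y = ε * f 0 ε / (1 - t) * ∑ k : Fin (2 * n + 1), f k.succ ε *
      (symSum t (twistTail t ε (fun i => f i.succ) k) (pmVars y) * evenDensity t y) := by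
  rw [peelKernel, inv_eq_of_mul_eq_one_left hε, sq, hε, mul_one]

theorem integral_symSum_mul_evenDensity_succ (ht : ‖t‖ < 1) {C : ℂ}
    (ih : ∀ f : Fin (2 * n) → ℂ → ℂ, IsAdmissible f →
      ∫ x, symSum t f (pmVars x) * evenDensity t x ∂torusMeasure n = C * evenSum f)
    {f : Fin (2 * n + 2) → ℂ → ℂ} (hf : IsAdmissible f) :
    ∫ x : Fin (n + 1) → ℂ, symSum t f (pmVars x) * evenDensity t x ∂torusMeasure (n + 1) =
      (n + 1) * (Real.pi / (1 - t) * C) * evenSum f := by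
  have ht1 : 1 - t ≠ 0 := by simpa using one_sub_mul_ne_zero ht norm_one
  have hint := integrable_peelQuotient ht hf.lip fun g hg => integrable_symSum_mul_evenDensity ht hg
  have hmp := measurePreserving_piFinSuccAbove_torusMeasure (n := n)
  have hint' : ∀ j : Fin (n + 1), Integrable (fun x => peelQuotient t f
      (MeasurableEquiv.piFinSuccAbove (fun _ => ℂ) j x)) (torusMeasure (n + 1)) := fun j =>
    (hmp j).integrable_comp_of_integrable hint
  rw [integral_congr_ae (ae_symSum_mul_evenDensity_eq_sum ht f),
    integral_finsetSum _ fun j _ => hint' j]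
  have h1 : ∀ j : Fin (n + 1), ∫ x, peelQuotient t f
      (MeasurableEquiv.piFinSuccAbove (fun _ => ℂ) j x) ∂torusMeasure (n + 1) =
      ∫ y, Real.pi * (peelKernel t f 1 y - peelKernel t f (-1) y) ∂torusMeasure n := by
    intro j
    rw [(hmp j).integral_comp', integral_prod_symm _ hint]
    refine integral_congr_ae ?_
    filter_upwards [ae_torusMeasure_norm n] with y hy
    exact (hf.extendsToDisc_peelKernel ht hy).integral_sub_inv_div
  simp only [h1, sum_const, card_univ, Fintype.card_fin, nsmul_eq_mul]
  have htail : IsAdmissible fun i => f (Fin.succ i) := hf.comp Fin.strictMono_succ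
  have h2 : ∀ ε : ℂ, ε * ε = 1 →
      Integrable (fun y => peelKernel t f ε y) (torusMeasure n) ∧
      ∫ y, peelKernel t f ε y ∂torusMeasure n = ε * f 0 ε / (1 - t) *
        (C * ∑ k : Fin (2 * n + 1),
          f k.succ ε * evenSum (twistTail t ε (fun i => f i.succ) k)) := by
    intro ε hε
    have hi : ∀ k : Fin (2 * n + 1), Integrable (fun y => f k.succ ε *
        (symSum t (twistTail t ε (fun i => f i.succ) k) (pmVars y) * evenDensity t y))
        (torusMeasure n) := fun k =>
      (integrable_symSum_mul_evenDensity ht (htail.twistTail ht hε k).lip).const_mul _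
    simp only [peelKernel_of_mul_self f hε]
    refine ⟨(integrable_finsetSum _ fun k _ => hi k).const_mul _, ?_⟩
    rw [integral_const_mul, integral_finsetSum _ fun k _ => hi k]
    congr 1
    rw [mul_sum]
    refine sum_congr rfl fun k _ => ?_
    rw [integral_const_mul, ih _ (htail.twistTail ht hε k)]
    ring
  have hp := h2 1 (by norm_num)
  have hm := h2 (-1) (by norm_num)
  rw [integral_const_mul, integral_sub hp.1 hm.1, hp.2, hm.2,
    sum_mul_evenSum_twistTail_one ht (even_two_mul n),
    sum_mul_evenSum_twistTail_neg_one ht]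
  have h3 : evenSum f = _ := evenSum_succ (N := 2 * n + 1) f
  rw [h3]
  push_cast
  field_simp
  ring

/-- The integral over the identity component of `O(2n)`, for a product of arbitrary admissible
functions. -/
theorem exists_integral_symSum_mul_evenDensity (ht : ‖t‖ < 1) (n : ℕ) :
    ∃ C : ℂ, C ≠ 0 ∧ ∀ f : Fin (2 * n) → ℂ → ℂ, IsAdmissible f →
      ∫ x, symSum t f (pmVars x) * evenDensity t x ∂torusMeasure n = C * evenSum f := by
  induction n with
  | zero =>
    refine ⟨1 / 2, by norm_num, fun f _ => ?_⟩
    have h : ∀ x : Fin 0 → ℂ, symSum t f (pmVars x) * evenDensity t x = 1 := by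
      intro x
      simp [symSum, evenDensity]
    have h2 : (torusMeasure 0).real Set.univ = 1 := by
      simp [torusMeasure, Measure.real]
    simp only [h]
    rw [integral_const, h2]
    simp [evenSum, signProd]
    norm_num
  | succ n ih =>
    obtain ⟨C, hC, ih⟩ := ih
    have ht1 : 1 - t ≠ 0 := by simpa using one_sub_mul_ne_zero ht norm_one
    refine ⟨(n + 1) * (Real.pi / (1 - t) * C), mul_ne_zero (Nat.cast_add_one_ne_zero n)
      (mul_ne_zero (div_ne_zero (by exact_mod_cast Real.pi_ne_zero) ht1) hC),
      fun f hf => integral_symSum_mul_evenDensity_succ ht ih hf⟩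

end Evaluation

/-! ### The four components of the orthogonal groups -/

section Mean

open MeasureTheory

theorem torusMean_eq_integral {n : ℕ} {f : (Fin n → ℂ) → ℂ}
    (hf : AEStronglyMeasurable f (torusMeasure n)) :
    torusMean f = (2 * (Real.pi : ℂ))⁻¹ ^ n * ∫ x, f x ∂torusMeasure n := by
  have hmap : torusMeasure n = (volume.restrict (Set.Icc (0 : Fin n → ℝ) fun _ => 2 * Real.pi)).map
      fun θ i => Complex.exp (θ i * Complex.I) := by
    have h1 : Set.Icc (0 : Fin n → ℝ) (fun _ => 2 * Real.pi) =
        Set.univ.pi fun _ => Set.Icc 0 (2 * Real.pi) := (Set.pi_univ_Icc _ _).symm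
    rw [h1, volume_pi, Measure.restrict_pi_pi]
    have : SigmaFinite (Measure.map (fun θ : ℝ => Complex.exp (θ * Complex.I))
      (volume.restrict (Set.Icc 0 (2 * Real.pi)))) := by
      have h := isFiniteMeasure_circMeasure
      unfold circMeasure at h
      infer_instance
    rw [Measure.pi_map_pi fun _ => measurable_exp_mul_I.aemeasurable]
    rfl
  have hmeas : Measurable fun (θ : Fin n → ℝ) i => Complex.exp (θ i * Complex.I) :=
    measurable_pi_lambda _ fun i => measurable_exp_mul_I.comp (measurable_pi_apply i)
  rw [hmap] at hf ⊢
  rw [integral_map hmeas.aemeasurable hf, torusMean, torusIntegral, ← integral_const_mul]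
  refine integral_congr_ae (.of_forall fun θ => ?_)
  have hx : torusMap (fun _ => 0) (fun _ => 1) θ = fun i => Complex.exp (θ i * Complex.I) := by
    ext i
    simp [torusMap]
  simp only [hx, smul_eq_mul, Complex.ofReal_one, one_mul]
  rw [← mul_assoc, ← prod_mul_distrib]
  congr 1
  rw [← Fin.prod_const]
  refine prod_congr rfl fun i _ => ?_
  have := Complex.exp_ne_zero (θ i * Complex.I)
  have hpi : (Real.pi : ℂ) ≠ 0 := by exact_mod_cast Real.pi_ne_zero
  field_simp

end Mean

section Components

open MeasureTheory

variable {n N : ℕ} {t : ℂ}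

/-- `z` is the alphabet and `Δ` the density of a component of an orthogonal group: the integral of a
symmetrization with admissible factors is a nonzero multiple of `S`. -/
structure IsOrthogonalComponent (t : ℂ) (z : (Fin n → ℂ) → Fin N → ℂ) (Δ : (Fin n → ℂ) → ℂ)
    (S : (Fin N → ℂ → ℂ) → ℂ) : Prop where
  generic : ∀ᵐ x ∂torusMeasure n, Function.Injective (z x) ∧ ∀ l, ‖z x l‖ = 1
  integrable : ∀ f : Fin N → ℂ → ℂ, (∀ i, CircleLip (f i)) →
    Integrable (fun x => symSum t f (z x) * Δ x) (torusMeasure n)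
  integral : ∃ C : ℂ, C ≠ 0 ∧ ∀ f : Fin N → ℂ → ℂ, IsAdmissible f →
    ∫ x, symSum t f (z x) * Δ x ∂torusMeasure n = C * S f

/-- Adjoining the eigenvalue `ε = ±1` to the alphabet: `hΔ` compares the densities, and `hS` is the
telescoping identity for the sum over the positions of `ε`. -/
theorem IsOrthogonalComponent.adjoin (ht : ‖t‖ < 1) {z : (Fin n → ℂ) → Fin (N + 1) → ℂ}
    {z' : (Fin n → ℂ) → Fin N → ℂ} {Δ Δ' : (Fin n → ℂ) → ℂ} {S : (Fin (N + 1) → ℂ → ℂ) → ℂ}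
    {S' : (Fin N → ℂ → ℂ) → ℂ} (h : IsOrthogonalComponent t z' Δ' S') {ε c : ℂ} (hε : ε * ε = 1)
    (hc : c ≠ 0) (hz : ∀ x, univ.val.map (z x) = ε ::ₘ univ.val.map (z' x))
    (hne : ∀ᵐ x ∂torusMeasure n, ∀ l, z' x l ≠ ε)
    (hΔ : ∀ᵐ x ∂torusMeasure n, Δ x * ∏ l, (ε - t * z' x l) / (ε - z' x l) = c * Δ' x)
    (hS : ∀ f : Fin (N + 1) → ℂ → ℂ, ∑ k, f k ε * S' (twistTail t ε f k) = S f) :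
    IsOrthogonalComponent t z Δ S := by
  have hε1 : ‖ε‖ = 1 := by
    have h : ‖ε‖ * ‖ε‖ = 1 := by rw [← norm_mul, hε, norm_one]
    nlinarith [norm_nonneg ε]
  have hz' : ∀ x, univ.val.map (z x) = univ.val.map (Fin.cons ε (z' x) : Fin (N + 1) → ℂ) := by
    intro x
    rw [hz, map_univ_succAbove (Fin.cons ε (z' x) : Fin (N + 1) → ℂ) 0]
    rfl
  have key : ∀ f : Fin (N + 1) → ℂ → ℂ, (fun x => symSum t f (z x) * Δ x) =ᵐ[torusMeasure n]
      fun x => ∑ k, c * f k ε * (symSum t (twistTail t ε f k) (z' x) * Δ' x) := by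
    intro f
    filter_upwards [h.generic, hne, hΔ] with x hx hnex hΔx
    rw [symSum_congr_multiset t f (hz' x), symSum_cons_eq_sum_twistTail ht f hε1 hx.2 hnex,
      inv_eq_of_mul_eq_one_left hε, mul_right_comm, mul_comm _ (Δ x), hΔx, mul_sum]
    exact sum_congr rfl fun k _ => by ring
  have hlip : ∀ f : Fin (N + 1) → ℂ → ℂ, (∀ i, CircleLip (f i)) → ∀ k i,
      CircleLip (twistTail t ε f k i) := by
    intro f hf k i
    refine (hf _).mul ?_
    split_ifs
    · exact .twist ht hε1
    · exact UnifLip.const 1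
  have hint : ∀ f : Fin (N + 1) → ℂ → ℂ, (∀ i, CircleLip (f i)) → ∀ k, Integrable (fun x =>
      c * f k ε * (symSum t (twistTail t ε f k) (z' x) * Δ' x)) (torusMeasure n) := fun f hf k =>
    (h.integrable _ (hlip f hf k)).const_mul _
  obtain ⟨C, hC, hI⟩ := h.integral
  refine ⟨?_, fun f hf => ?_, c * C, mul_ne_zero hc hC, fun f hf => ?_⟩
  · filter_upwards [h.generic, hne] with x hx hnex
    obtain ⟨σ, hσ⟩ := exists_perm_of_map_univ_eq (hz' x)
    rw [hσ]
    refine ⟨(Fin.cons_injective_iff.2 ⟨?_, hx.1⟩).comp σ.injective, fun l => ?_⟩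
    · rintro ⟨l, hl⟩
      exact hnex l hl
    · rw [Function.comp_apply]
      generalize σ l = m
      refine Fin.cases ?_ (fun i => ?_) m
      · exact hε1
      · exact hx.2 i
  · exact (integrable_finsetSum _ fun k _ => hint f hf k).congr (key f).symm
  · rw [integral_congr_ae (key f), integral_finsetSum _ fun k _ => hint f hf.lip k, ← hS, mul_sum]
    refine sum_congr rfl fun k _ => ?_
    rw [integral_const_mul, hI _ (hf.twistTail ht hε k)]
    ring

theorem koornwinderDensity_eq_evenDensity {s : ℂ} (hs : s ^ 2 = t) {x : Fin n → ℂ}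
    (hx : IsGeneric x) : koornwinderDensity 1 (-1) s (-s) t x =
      1 / (2 ^ n * (n.factorial : ℂ)) * evenDensity t x := by
  unfold koornwinderDensity evenDensity
  rw [mul_assoc]
  congr 2
  refine prod_congr rfl fun i _ => ?_
  have h0 := ne_zero_of_norm_eq_one (hx.norm_eq i)
  have h1 : 1 - x i ≠ 0 := sub_ne_zero.2 (hx.ne_one i).symm
  have h2 : 1 + x i ≠ 0 := fun h => hx.ne_neg_one i (eq_neg_of_add_eq_zero_right h)
  have e1 : (1 - x i ^ 2) * (1 - (x i)⁻¹ ^ 2) =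
      ((1 - 1 * x i) * (1 - 1 * (x i)⁻¹)) * ((1 - -1 * x i) * (1 - -1 * (x i)⁻¹)) := by ring
  have e2 : (1 - 1 * x i) * (1 - 1 * (x i)⁻¹) * ((1 - -1 * x i) * (1 - -1 * (x i)⁻¹)) ≠ 0 := by
    have : (1 - 1 * x i) * (1 - 1 * (x i)⁻¹) * ((1 - -1 * x i) * (1 - -1 * (x i)⁻¹)) =
        -((1 - x i) * (1 + x i) * (x i)⁻¹) ^ 2 := by
      field_simp
      ring
    rw [this]
    exact neg_ne_zero.2 (pow_ne_zero _ (mul_ne_zero (mul_ne_zero h1 h2) (inv_ne_zero h0)))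
  have e3 : (1 - s * x i) * (1 - s * (x i)⁻¹) * ((1 - -s * x i) * (1 - -s * (x i)⁻¹)) =
      (1 - t * x i ^ 2) * (1 - t * (x i)⁻¹ ^ 2) := by
    rw [← hs]
    ring
  rw [e1, mul_assoc (_ * _) (_ * _) (_ * _), e3, div_mul_eq_div_div, div_self e2, one_div]

/-- A product of one-variable factors over the alphabet changes two of the four parameters. -/
theorem koornwinderDensity_mul_prod {a b a' b' c d : ℂ} (g : ℂ → ℂ) {x : Fin n → ℂ}
    (hg : ∀ i, (((1 - a * x i) * (1 - a * (x i)⁻¹)) * ((1 - b * x i) * (1 - b * (x i)⁻¹)))⁻¹ *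
      (g (x i) * g (x i)⁻¹) =
        (((1 - a' * x i) * (1 - a' * (x i)⁻¹)) * ((1 - b' * x i) * (1 - b' * (x i)⁻¹)))⁻¹) :
    koornwinderDensity a b c d t x * ∏ l, g (pmVars x l) = koornwinderDensity a' b' c d t x := by
  unfold koornwinderDensity
  rw [prod_pmVars, mul_right_comm, mul_assoc (1 / _), ← prod_mul_distrib]
  congr 2
  refine prod_congr rfl fun i _ => ?_
  simp only [div_eq_mul_inv, mul_inv] at hg ⊢
  linear_combination (1 - x i ^ 2) * (1 - (x i)⁻¹ ^ 2) *
    ((1 - c * x i)⁻¹ * (1 - c * (x i)⁻¹)⁻¹ * ((1 - d * x i)⁻¹ * (1 - d * (x i)⁻¹)⁻¹)) * hg i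

/-- Adjoining the eigenvalue `1` replaces the parameter `1` by `t`. -/
theorem koornwinderDensity_adjoin_one (ht : ‖t‖ < 1) (b c d : ℂ) {x : Fin n → ℂ}
    (hx : IsGeneric x) :
    koornwinderDensity t b c d t x * ∏ l, (1 - t * pmVars x l) / (1 - pmVars x l) =
      koornwinderDensity 1 b c d t x := by
  refine koornwinderDensity_mul_prod (fun u => (1 - t * u) / (1 - u)) fun i => ?_
  have h1 := one_sub_mul_ne_zero ht (hx.norm_eq i)
  have h2 := one_sub_mul_ne_zero ht (x := (x i)⁻¹) (by rw [norm_inv, hx.norm_eq, inv_one])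
  simp only [one_mul, mul_inv, div_eq_mul_inv]
  generalize 1 - t * x i = A at *
  generalize 1 - t * (x i)⁻¹ = B at *
  generalize 1 - b * x i = P
  generalize 1 - b * (x i)⁻¹ = Q
  generalize 1 - x i = U
  generalize 1 - (x i)⁻¹ = V
  field_simp

/-- Adjoining the eigenvalue `-1` replaces the parameter `-1` by `-t`. -/
theorem koornwinderDensity_adjoin_neg_one (ht : ‖t‖ < 1) (a c d : ℂ) {x : Fin n → ℂ}
    (hx : IsGeneric x) :
    koornwinderDensity a (-t) c d t x * ∏ l, (-1 - t * pmVars x l) / (-1 - pmVars x l) =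
      koornwinderDensity a (-1) c d t x := by
  refine koornwinderDensity_mul_prod (fun u => (-1 - t * u) / (-1 - u)) fun i => ?_
  have h1 : 1 - -t * x i ≠ 0 := one_sub_mul_ne_zero (by rwa [norm_neg]) (hx.norm_eq i)
  have h2 : 1 - -t * (x i)⁻¹ ≠ 0 :=
    one_sub_mul_ne_zero (by rwa [norm_neg]) (by rw [norm_inv, hx.norm_eq, inv_one])
  have e : ∀ u : ℂ, (-1 - t * u) / (-1 - u) = (1 - -t * u) * (1 - -1 * u)⁻¹ := by
    intro u
    rw [← neg_div_neg_eq, div_eq_mul_inv]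
    ring_nf
  simp only [e, mul_inv]
  generalize 1 - -t * x i = A at *
  generalize 1 - -t * (x i)⁻¹ = B at *
  generalize 1 - a * x i = P
  generalize 1 - a * (x i)⁻¹ = Q
  generalize 1 - -1 * x i = U
  generalize 1 - -1 * (x i)⁻¹ = V
  field_simp

theorem isOrthogonalComponent_even (ht : ‖t‖ < 1) {s : ℂ} (hs : s ^ 2 = t) (n : ℕ) :
    IsOrthogonalComponent t (fun x : Fin n → ℂ => pmVars x)
      (koornwinderDensity 1 (-1) s (-s) t) evenSum := by
  have hc : 1 / (2 ^ n * (n.factorial : ℂ)) ≠ 0 := one_div_ne_zero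
    (mul_ne_zero (pow_ne_zero _ two_ne_zero) (by exact_mod_cast n.factorial_ne_zero))
  have key : ∀ f : Fin (2 * n) → ℂ → ℂ,
      (fun x => symSum t f (pmVars x) * koornwinderDensity 1 (-1) s (-s) t x) =ᵐ[torusMeasure n]
      fun x => 1 / (2 ^ n * (n.factorial : ℂ)) * (symSum t f (pmVars x) * evenDensity t x) := by
    intro f
    filter_upwards [ae_isGeneric n] with x hx
    rw [koornwinderDensity_eq_evenDensity hs hx]
    ring
  obtain ⟨C, hC, hI⟩ := exists_integral_symSum_mul_evenDensity ht n
  refine ⟨?_, fun f hf => ?_, _, mul_ne_zero hc hC, fun f hf => ?_⟩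
  · filter_upwards [ae_isGeneric n] with x hx
    exact ⟨hx.injective_pmVars, norm_pmVars hx.norm_eq⟩
  · exact ((integrable_symSum_mul_evenDensity ht hf).const_mul _).congr (key f).symm
  · rw [integral_congr_ae (key f), integral_const_mul, hI f hf, mul_assoc]

theorem map_append {m : ℕ} (z : Fin N → ℂ) (w : Fin m → ℂ) :
    univ.val.map (Fin.append z w) = univ.val.map z + univ.val.map w := by
  have hm : ∀ {m : ℕ} (z : Fin m → ℂ), univ.val.map z = ∑ l, ({z l} : Multiset ℂ) := by
    intro m z
    rw [← Multiset.sum_map_singleton (univ.val.map z), Multiset.map_map]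
    rfl
  rw [hm, hm, hm, Fin.sum_univ_add]
  simp

theorem IsGeneric.pmVars_ne {x : Fin n → ℂ} (hx : IsGeneric x) (l : Fin (2 * n)) :
    pmVars x l ≠ 1 ∧ pmVars x l ≠ -1 := by
  refine forall_pmVars (p := fun u => u ≠ 1 ∧ u ≠ -1) (fun i =>
    ⟨⟨hx.ne_one i, hx.ne_neg_one i⟩, fun h => hx.ne_one i ?_, fun h => hx.ne_neg_one i ?_⟩) l
  · rw [← inv_inv (x i), h, inv_one]
  · rw [← inv_inv (x i), h, inv_neg, inv_one]

theorem isOrthogonalComponent_one (ht : ‖t‖ < 1) {s : ℂ} (hs : s ^ 2 = t) (n : ℕ) :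
    IsOrthogonalComponent t (fun x : Fin n → ℂ => Fin.append (pmVars x) ![1])
      (koornwinderDensity t (-1) s (-s) t) evenSum := by
  refine (isOrthogonalComponent_even ht hs n).adjoin ht (one_mul 1) one_ne_zero (fun x => ?_) ?_ ?_
    fun f => sum_mul_evenSum_twistTail_one ht (even_two_mul n) f
  · rw [map_append, add_comm]
    rfl
  · exact (ae_isGeneric n).mono fun x hx l => (hx.pmVars_ne l).1
  · exact (ae_isGeneric n).mono fun x hx => by
      rw [koornwinderDensity_adjoin_one ht _ _ _ hx, one_mul]

theorem isOrthogonalComponent_neg_one (ht : ‖t‖ < 1) {s : ℂ} (hs : s ^ 2 = t) (n : ℕ) :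
    IsOrthogonalComponent t (fun x : Fin n → ℂ => Fin.append (pmVars x) ![-1])
      (koornwinderDensity 1 (-t) s (-s) t) oddSum := by
  refine (isOrthogonalComponent_even ht hs n).adjoin ht (ε := -1) (by norm_num) one_ne_zero
    (fun x => ?_) ?_ ?_ fun f => sum_mul_evenSum_twistTail_neg_one ht f
  · rw [map_append, add_comm]
    rfl
  · exact (ae_isGeneric n).mono fun x hx l => (hx.pmVars_ne l).2
  · exact (ae_isGeneric n).mono fun x hx => by
      rw [koornwinderDensity_adjoin_neg_one ht _ _ _ hx, one_mul]

theorem isOrthogonalComponent_one_neg_one (ht : ‖t‖ < 1) {s : ℂ} (hs : s ^ 2 = t) (n : ℕ) :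
    IsOrthogonalComponent t (fun x : Fin n → ℂ => Fin.append (pmVars x) ![1, -1])
      (koornwinderDensity t (-t) s (-s) t) oddSum := by
  have ht1 : 1 + t ≠ 0 := by simpa using one_sub_mul_ne_zero ht (x := -1) (by simp)
  refine (isOrthogonalComponent_neg_one ht hs n).adjoin ht (c := (1 + t) / 2) (one_mul 1)
    (div_ne_zero ht1 two_ne_zero) (fun x => ?_) ?_ ?_
    fun f => sum_mul_oddSum_twistTail_one ht (odd_two_mul_add_one n) f
  · have h : (univ.val.map ![(1 : ℂ), -1]) = 1 ::ₘ univ.val.map ![(-1 : ℂ)] := rfl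
    rw [map_append, map_append, h, Multiset.add_cons]
  · refine (ae_isGeneric n).mono fun x hx l => ?_
    refine Fin.addCases (fun i => ?_) (fun i => ?_) l
    · rw [Fin.append_left]
      exact (hx.pmVars_ne i).1
    · rw [Fin.append_right, Matrix.cons_val_fin_one]
      norm_num
  · refine (ae_isGeneric n).mono fun x hx => ?_
    rw [Fin.prod_univ_add]
    simp only [Fin.append_left, Fin.append_right, univ_unique, prod_singleton,
      Matrix.cons_val_fin_one]
    rw [← mul_assoc, koornwinderDensity_adjoin_one ht _ _ _ hx, mul_comm]
    norm_num

end Components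

/-! ### Rogers-Szegő sums over subsets, and straightening of compositions -/

section RogersSzego

variable {t : ℂ}

theorem tInt_succ_ne_zero (ht : ‖t‖ < 1) (k : ℕ) : tInt t (k + 1) ≠ 0 := by
  have h1 : 1 - t ≠ 0 := by simpa using one_sub_mul_ne_zero ht norm_one
  refine div_ne_zero (fun h => ?_) h1
  have h2 : ‖t‖ ^ (k + 1) = 1 := by rw [← norm_pow, ← sub_eq_zero.1 h, norm_one]
  exact (pow_lt_one₀ (norm_nonneg t) ht k.succ_ne_zero).ne h2

theorem tFactorial_ne_zero (ht : ‖t‖ < 1) (m : ℕ) : tFactorial t m ≠ 0 :=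
  prod_ne_zero_iff.2 fun k _ => tInt_succ_ne_zero ht k

theorem tFactorial_succ (m : ℕ) : tFactorial t (m + 1) = tFactorial t m * tInt t (m + 1) :=
  prod_range_succ _ _

theorem tFactorial_zero : tFactorial t 0 = 1 := prod_range_zero _

/-- The `t`-Pascal rule in generating function form. -/
theorem rogersSzego_succ (ht : ‖t‖ < 1) (m : ℕ) (z : ℂ) :
    rogersSzego (m + 1) z t = z * rogersSzego m z t + rogersSzego m (t * z) t := by
  have hF := tFactorial_ne_zero ht
  have hpascal : ∀ i ∈ range m,
      tFactorial t (m + 1) / (tFactorial t (m + 1 - (i + 1)) * tFactorial t (i + 1)) =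
        tFactorial t m / (tFactorial t (m - i) * tFactorial t i) + t ^ (i + 1) *
          (tFactorial t m / (tFactorial t (m - (i + 1)) * tFactorial t (i + 1))) := by
    intro i hi
    obtain ⟨d, rfl⟩ : ∃ d, m = i + 1 + d := ⟨m - (i + 1), by have := mem_range.1 hi; omega⟩
    rw [show i + 1 + d + 1 - (i + 1) = d + 1 by omega, show i + 1 + d - i = d + 1 by omega,
      show i + 1 + d - (i + 1) = d by omega, tFactorial_succ (i + 1 + d), tFactorial_succ d,
      tFactorial_succ i]
    have h1 := tInt_succ_ne_zero ht d
    have h2 := tInt_succ_ne_zero ht i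
    have h3 : tInt t (i + 1 + d + 1) = tInt t (i + 1) + t ^ (i + 1) * tInt t (d + 1) := by
      have h4 : 1 - t ≠ 0 := by simpa using one_sub_mul_ne_zero ht norm_one
      unfold tInt
      field_simp
      ring
    have h5 := hF (i + 1 + d)
    have h6 := hF d
    have h7 := hF i
    rw [h3]
    field_simp
  unfold rogersSzego
  rw [sum_range_succ' _ (m + 1), sum_range_succ _ m, sum_range_succ _ m, sum_range_succ' _ m]
  rw [sum_congr rfl fun i hi => congrArg (z ^ (i + 1) * ·) (hpascal i hi)]
  simp only [Nat.sub_zero, Nat.sub_self, tFactorial_zero, one_mul, mul_one, pow_zero,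
    div_self (hF _), mul_add, sum_add_distrib, mul_sum]
  rw [sum_congr rfl fun i _ => show z ^ (i + 1) * (tFactorial t m /
      (tFactorial t (m - i) * tFactorial t i)) = z * (z ^ i * (tFactorial t m /
      (tFactorial t (m - i) * tFactorial t i))) by ring,
    sum_congr rfl fun i _ => show z ^ (i + 1) * (t ^ (i + 1) * (tFactorial t m /
      (tFactorial t (m - (i + 1)) * tFactorial t (i + 1)))) = (t * z) ^ (i + 1) * (tFactorial t m /
      (tFactorial t (m - (i + 1)) * tFactorial t (i + 1))) by ring]
  ring

theorem rogersSzego_zero (z : ℂ) : rogersSzego 0 z t = 1 := by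
  simp [rogersSzego, tFactorial_zero]

theorem sum_finset_fin_succ {N : ℕ} (F : Finset (Fin (N + 1)) → ℂ) :
    ∑ S, F S = ∑ S : Finset (Fin N),
      (F (S.map (Fin.succEmb N)) + F (insert 0 (S.map (Fin.succEmb N)))) := by
  rw [← powerset_univ, Fin.univ_succ, cons_eq_insert, sum_powerset_insert (by simp),
    sum_add_distrib]
  have h : ∀ G : Finset (Fin (N + 1)) → ℂ,
      ∑ S ∈ (univ.map ⟨Fin.succ, Fin.succ_injective N⟩).powerset, G S =
        ∑ S : Finset (Fin N), G (S.map (Fin.succEmb N)) := by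
    intro G
    symm
    refine sum_bij (fun S _ => S.map (Fin.succEmb N)) (fun S _ => ?_) (fun S _ S' _ h => ?_)
      (fun T hT => ?_) fun _ _ => rfl
    · exact mem_powerset.2 (map_subset_map.2 (subset_univ S))
    · exact map_injective _ h
    · obtain ⟨u, -, hu⟩ := subset_map_iff.1 (mem_powerset.1 hT)
      exact ⟨u, mem_univ _, hu.symm⟩
  rw [h, h]

theorem partMult_succ {N : ℕ} (μ : Fin (N + 1) → ℕ) (v : ℕ) :
    partMult μ v = (if μ 0 = v then 1 else 0) + partMult (fun i => μ i.succ) v := by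
  simp only [partMult, card_filter, Fin.sum_univ_succ]

/-- The weighted sum over the subsets of the set of parts factors over the values of the parts. Only
the pairs of equal parts interact, and each value `v` contributes a Rogers-Szegő polynomial by the
`t`-Pascal rule, applied to the first part. -/
theorem sum_finset_eq_prod_rogersSzego (ht : ‖t‖ < 1) {N : ℕ} (μ : Fin N → ℕ) {M : ℕ}
    (hM : ∀ i, μ i < M) (y : ℕ → ℂ) :
    ∑ S : Finset (Fin N), (∏ i ∈ S, y (μ i)) *
      ∏ a, ∏ b ∈ Ioi a, (if μ a = μ b ∧ a ∉ S ∧ b ∈ S then t else 1) =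
      ∏ v ∈ range M, rogersSzego (partMult μ v) (y v) t := by
  induction N generalizing y with
  | zero =>
    have h : ∀ v, partMult μ v = 0 := fun v => by simp [partMult]
    simp only [h, rogersSzego_zero, prod_const_one, univ_eq_empty, prod_empty, mul_one]
    rw [Fintype.sum_unique]
    exact prod_eq_one fun i _ => i.elim0
  | succ N ih =>
    rw [sum_finset_fin_succ]
    have h0 : ∀ S : Finset (Fin N), (0 : Fin (N + 1)) ∉ S.map (Fin.succEmb N) := by simp
    have hsucc : ∀ (S : Finset (Fin N)) (i : Fin N), i.succ ∈ S.map (Fin.succEmb N) ↔ i ∈ S := by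
      simp
    have hsucc' : ∀ (S : Finset (Fin N)) (i : Fin N),
        i.succ ∈ insert 0 (S.map (Fin.succEmb N)) ↔ i ∈ S := by
      simp
    -- a first part outside the subset contributes a factor `t` for each chosen part of equal value
    let y' : ℕ → ℂ := Function.update y (μ 0) (t * y (μ 0))
    have hterm : ∀ S : Finset (Fin N),
        ((∏ i ∈ S.map (Fin.succEmb N), y (μ i)) * ∏ a, ∏ b ∈ Ioi a,
          (if μ a = μ b ∧ a ∉ S.map (Fin.succEmb N) ∧ b ∈ S.map (Fin.succEmb N) then t else 1)) =
        (∏ i ∈ S, y' (μ i.succ)) * ∏ a : Fin N, ∏ b ∈ Ioi a,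
          (if μ a.succ = μ b.succ ∧ a ∉ S ∧ b ∈ S then t else 1) := by
      intro S
      rw [prod_Ioi_succAbove 0]
      simp only [Fin.succAbove_zero, Fin.not_lt_zero, if_false, hsucc, h0, not_false_eq_true,
        true_and, prod_map, Fin.coe_succEmb, ← mul_assoc]
      congr 1
      rw [show (∏ i : Fin N, if μ 0 = μ i.succ ∧ i ∈ S then t else 1) =
        ∏ i ∈ S, if μ 0 = μ i.succ then t else 1 by
          rw [← prod_filter, ← prod_filter]
          refine prod_congr (by ext; simp [and_comm]) fun _ _ => rfl, ← prod_mul_distrib]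
      refine prod_congr rfl fun i _ => ?_
      by_cases h : μ 0 = μ i.succ
      · simp [y', ← h, mul_comm]
      · simp [y', h, Function.update_of_ne (Ne.symm h)]
    have hterm' : ∀ S : Finset (Fin N),
        ((∏ i ∈ insert 0 (S.map (Fin.succEmb N)), y (μ i)) * ∏ a, ∏ b ∈ Ioi a,
          (if μ a = μ b ∧ a ∉ insert 0 (S.map (Fin.succEmb N)) ∧
            b ∈ insert 0 (S.map (Fin.succEmb N)) then t else 1)) =
        y (μ 0) * ((∏ i ∈ S, y (μ i.succ)) * ∏ a : Fin N, ∏ b ∈ Ioi a,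
          (if μ a.succ = μ b.succ ∧ a ∉ S ∧ b ∈ S then t else 1)) := by
      intro S
      rw [prod_Ioi_succAbove 0, prod_insert (h0 S)]
      simp only [Fin.succAbove_zero, Fin.not_lt_zero, if_false, hsucc', mem_insert_self,
        not_true_eq_false, false_and, and_false, prod_const_one, one_mul, prod_map,
        Fin.coe_succEmb]
      ring
    rw [sum_congr rfl fun S _ => congrArg₂ (· + ·) (hterm S) (hterm' S), sum_add_distrib,
      ← mul_sum, ih (fun i => μ i.succ) (fun i => hM _) y',
      ih (fun i => μ i.succ) (fun i => hM _) y]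
    have hmem : μ 0 ∈ range M := mem_range.2 (hM 0)
    rw [← mul_prod_erase _ _ hmem, ← mul_prod_erase _ _ hmem, ← mul_prod_erase _ _ hmem,
      prod_congr rfl fun v hv => show rogersSzego (partMult (fun i => μ i.succ) v) (y' v) t =
        rogersSzego (partMult μ v) (y v) t by
          rw [partMult_succ, if_neg (ne_of_mem_erase hv).symm, zero_add,
            show y' v = y v from Function.update_of_ne (ne_of_mem_erase hv) _ _],
      prod_congr rfl fun v hv => show rogersSzego (partMult (fun i => μ i.succ) v) (y v) t =
        rogersSzego (partMult μ v) (y v) t by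
          rw [partMult_succ μ, if_neg (ne_of_mem_erase hv).symm, zero_add]]
    rw [partMult_succ μ (μ 0), if_pos rfl, add_comm 1, rogersSzego_succ ht,
      show y' (μ 0) = t * y (μ 0) from Function.update_self _ _ _]
    ring

theorem finprod_eq_prod_range {f : ℕ → ℂ} {M : ℕ} (hf : ∀ i, M ≤ i → f i = 1) :
    ∏ᶠ i, f i = ∏ i ∈ range M, f i := by
  refine finprod_eq_prod_of_mulSupport_subset _ fun i hi => ?_
  by_contra h
  exact hi (hf i (by simpa using h))

theorem prod_range_two_mul (f : ℕ → ℂ) (M : ℕ) :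
    ∏ v ∈ range (2 * M), f v = (∏ i ∈ range M, f (2 * i)) * ∏ i ∈ range M, f (2 * i + 1) := by
  induction M with
  | zero => simp
  | succ M ih =>
    rw [Nat.mul_succ, prod_range_succ, prod_range_succ, prod_range_succ, prod_range_succ, ih]
    ring

end RogersSzego

section Straightening

/-- A functional on compositions that picks up a factor `t` when an ascent by one is removed is
determined by its values at partitions, for compositions without larger ascents. -/
theorem eq_prod_mul_of_swap_of_antitone {N : ℕ} {t : ℂ} {L G : (Fin (N + 1) → ℕ) → ℂ}
    (hswap : ∀ (ν : Fin (N + 1) → ℕ) (i : Fin N), ν i.succ = ν i.castSucc + 1 →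
      L ν = t * L (ν ∘ Equiv.swap i.castSucc i.succ))
    (hanti : ∀ ν, Antitone ν → L ν = G ν) (hG : ∀ ν (σ : Equiv.Perm (Fin (N + 1))), G (ν ∘ σ) = G ν)
    (ν : Fin (N + 1) → ℕ) (hν : ∀ a b, a < b → ν b ≤ ν a + 1) :
    L ν = (∏ a, ∏ b ∈ Ioi a, if ν a < ν b then t else 1) * G ν := by
  -- removing an ascent by one lowers `∑ a ν_a` by one
  induction hm : ∑ a : Fin (N + 1), (a : ℕ) * ν a using Nat.strong_induction_on generalizing ν with
  | _ m ih =>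
  by_cases hanti' : Antitone ν
  · rw [hanti ν hanti', prod_eq_one fun a _ => prod_eq_one fun b hb =>
      if_neg (hanti' (mem_Ioi.1 hb).le).not_gt, one_mul]
  · rw [Fin.antitone_iff_succ_le] at hanti'
    push Not at hanti'
    obtain ⟨i, hi⟩ := hanti'
    have hi1 : ν i.succ = ν i.castSucc + 1 := le_antisymm (hν _ _ Fin.castSucc_lt_succ) hi
    obtain ⟨P, hP, hPσ⟩ := prod_Ioi_comp_swap_castSucc i
    set σ : Equiv.Perm (Fin (N + 1)) := Equiv.swap i.castSucc i.succ with hσ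
    have hσl : σ i.castSucc = i.succ := Equiv.swap_apply_left _ _
    have hσr : σ i.succ = i.castSucc := Equiv.swap_apply_right _ _
    have hlt : ∀ a b : Fin (N + 1), a < b → σ a < σ b ∨ a = i.castSucc ∧ b = i.succ := by
      intro a b hab
      simp only [hσ, Equiv.swap_apply_def, Fin.lt_def, Fin.ext_iff] at *
      split_ifs <;> simp at * <;> omega
    have hν' : ∀ a b, a < b → (ν ∘ σ) b ≤ (ν ∘ σ) a + 1 := by
      intro a b hab
      rcases hlt a b hab with h | ⟨rfl, rfl⟩
      · exact hν _ _ h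
      · rw [Function.comp_apply, Function.comp_apply, hσl, hσr]
        omega
    have hdec : ∑ a : Fin (N + 1), (a : ℕ) * (ν ∘ σ) a < m := by
      rw [← hm]
      have h : ∑ a : Fin (N + 1), ((a : ℤ) * ν a - (a : ℤ) * (ν ∘ σ) a) = 1 := by
        rw [Fintype.sum_eq_add i.castSucc i.succ (Fin.castSucc_lt_succ (i := i)).ne fun a ha => by
          rw [Function.comp_apply, hσ, Equiv.swap_apply_of_ne_of_ne ha.1 ha.2, sub_self]]
        rw [Function.comp_apply, Function.comp_apply, hσl, hσr, hi1]
        simp only [Fin.val_castSucc, Fin.val_succ]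
        push_cast
        ring
      rw [sum_sub_distrib] at h
      zify
      linarith
    rw [hswap ν i hi1, ih _ hdec _ hν' rfl, hG, hP, hP,
      ← hPσ fun a b => if ν a < ν b then t else 1]
    simp only [Function.comp_apply, hσl, hσr]
    rw [if_neg (by omega), if_pos (by omega)]
    ring

end Straightening

/-! ### Normalized means over the components -/

section ComponentMean

open MeasureTheory

variable {n N : ℕ} {t : ℂ}

theorem torusMean_const_mul (c : ℂ) (f : (Fin n → ℂ) → ℂ) :
    torusMean (fun x => c * f x) = c * torusMean f := by
  unfold torusMean
  simp only [mul_left_comm _ c]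
  exact torusIntegral_const_mul _ _ _ _

theorem torusMean_congr_ae {f g : (Fin n → ℂ) → ℂ} (hg : Integrable g (torusMeasure n))
    (h : f =ᵐ[torusMeasure n] g) : torusMean f = torusMean g := by
  rw [torusMean_eq_integral hg.aestronglyMeasurable,
    torusMean_eq_integral (hg.congr h.symm).aestronglyMeasurable, integral_congr_ae h]

theorem torusMean_sum {ι : Type*} (s : Finset ι) {f : ι → (Fin n → ℂ) → ℂ}
    (hf : ∀ i ∈ s, Integrable (f i) (torusMeasure n)) :
    torusMean (fun x => ∑ i ∈ s, f i x) = ∑ i ∈ s, torusMean (f i) := by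
  rw [torusMean_eq_integral (integrable_finsetSum s hf).aestronglyMeasurable,
    integral_finsetSum s hf, mul_sum]
  exact sum_congr rfl fun i hi => (torusMean_eq_integral (hf i hi).aestronglyMeasurable).symm

/-- The mean of the symmetrization of `∏ fᵢ(zᵢ)` with respect to the normalized density `Δ`. -/
noncomputable def componentMean (t : ℂ) (z : (Fin n → ℂ) → Fin N → ℂ) (Δ : (Fin n → ℂ) → ℂ)
    (f : Fin N → ℂ → ℂ) : ℂ :=
  (torusMean Δ)⁻¹ * torusMean fun x => symSum t f (z x) * Δ x

variable {z : (Fin n → ℂ) → Fin N → ℂ} {Δ : (Fin n → ℂ) → ℂ} {S : (Fin N → ℂ → ℂ) → ℂ}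

theorem isAdmissible_one : IsAdmissible fun (_ : Fin N) (_ : ℂ) => (1 : ℂ) :=
  ⟨fun _ => UnifLip.const 1, fun _ _ _ => .of_differentiable (by fun_prop)⟩

theorem IsOrthogonalComponent.symSum_one_ae (h : IsOrthogonalComponent t z Δ S) (ht : ‖t‖ < 1) :
    (fun x => symSum t (fun _ _ => 1) (z x) * Δ x) =ᵐ[torusMeasure n]
      fun x => tFactorial t N * Δ x := by
  have ht1 : t ≠ 1 := by
    rintro rfl
    simp at ht
  filter_upwards [h.generic] with x hx
  rw [symSum_one ht1 hx.1 fun l => ne_zero_of_norm_eq_one (hx.2 l)]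

/-- The unknown constant in the integrals is determined by the case `f = 1`, which also shows that
the total mass does not vanish. -/
theorem IsOrthogonalComponent.torusMean_eq (h : IsOrthogonalComponent t z Δ S) (ht : ‖t‖ < 1)
    (hS : S (fun _ _ => 1) = 2 ^ N) :
    torusMean Δ ≠ 0 ∧ ∀ f, IsAdmissible f →
      componentMean t z Δ f = tFactorial t N / 2 ^ N * S f := by
  have hF := tFactorial_ne_zero ht N
  have hΔ : Integrable Δ (torusMeasure n) := by
    have h1 := ((h.integrable _ isAdmissible_one.lip).congr (h.symSum_one_ae ht)).const_mul
      (tFactorial t N)⁻¹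
    simpa only [inv_mul_cancel_left₀ hF] using h1
  obtain ⟨C, hC, hI⟩ := h.integral
  have h1 := hI _ isAdmissible_one
  rw [integral_congr_ae (h.symSum_one_ae ht), integral_const_mul, hS] at h1
  have h2 : (2 : ℂ) ^ N ≠ 0 := pow_ne_zero _ two_ne_zero
  have hD : ∫ x, Δ x ∂torusMeasure n ≠ 0 := fun h0 => mul_ne_zero hC h2 (by rw [← h1, h0, mul_zero])
  have hp : (2 * (Real.pi : ℂ))⁻¹ ^ n ≠ 0 := pow_ne_zero _ (inv_ne_zero (mul_ne_zero two_ne_zero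
    (by exact_mod_cast Real.pi_ne_zero)))
  have hm := torusMean_eq_integral hΔ.aestronglyMeasurable
  refine ⟨hm ▸ mul_ne_zero hp hD, fun f hf => ?_⟩
  rw [componentMean, hm, torusMean_eq_integral (h.integrable f hf.lip).aestronglyMeasurable,
    hI f hf]
  generalize (∫ x, Δ x ∂torusMeasure n) = D at *
  generalize (2 * (Real.pi : ℂ))⁻¹ ^ n = p at *
  field_simp
  linear_combination -S f * h1

theorem IsOrthogonalComponent.componentMean_swap {z : (Fin n → ℂ) → Fin (N + 1) → ℂ}
    {S : (Fin (N + 1) → ℂ → ℂ) → ℂ} (h : IsOrthogonalComponent t z Δ S) {f : Fin (N + 1) → ℂ → ℂ}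
    (hf : ∀ i, CircleLip (f i)) {i : Fin N} (hi : ∀ u, f i.succ u = u * f i.castSucc u) :
    componentMean t z Δ f = t * componentMean t z Δ (f ∘ Equiv.swap i.castSucc i.succ) := by
  have key : (fun x => symSum t f (z x) * Δ x) =ᵐ[torusMeasure n]
      fun x => t * (symSum t (f ∘ Equiv.swap i.castSucc i.succ) (z x) * Δ x) := by
    filter_upwards [h.generic] with x hx
    rw [symSum_swap_castSucc t f i hi hx.1, mul_assoc]
  rw [componentMean, torusMean_congr_ae ((h.integrable _ fun j => hf _).const_mul t) key,
    torusMean_const_mul, componentMean, mul_left_comm]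
  rfl

/-- The functions `u ^ νᵢ (1 - α u)`. -/
def powWeight (α : ℂ) (ν : Fin N → ℕ) (i : Fin N) (u : ℂ) : ℂ :=
  u ^ ν i * (1 - α * u)

theorem circleLip_powWeight (α : ℂ) (ν : Fin N → ℕ) (i : Fin N) : CircleLip (powWeight α ν i) := by
  have h : UnifLip (Set.univ : Set Unit) fun x _ => x ^ ν i * (1 + -α * x) :=
    (UnifLip.id.pow _).mul ((UnifLip.const 1).add ((UnifLip.const _).mul UnifLip.id))
  simp only [neg_mul, ← sub_eq_add_neg] at h
  exact h

theorem isAdmissible_powWeight (α : ℂ) {ν : Fin N → ℕ} (hν : Antitone ν) :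
    IsAdmissible (powWeight α ν) := by
  refine ⟨circleLip_powWeight α ν, fun i j hij => ?_⟩
  obtain ⟨d, hd⟩ := Nat.exists_eq_add_of_le (hν hij.le)
  have h : ExtendsToDisc fun x => x ^ d * (1 - α * x) * (x - α) :=
    .of_differentiable (by fun_prop)
  refine h.congr fun x hx => ?_
  have h0 := ne_zero_of_norm_eq_one hx
  simp only [powWeight]
  rw [hd, pow_add, inv_pow]
  field_simp

/-- Expanding `∏ (1 - β zₗ)` turns the Hall-Littlewood polynomial into a sum over the subsets of
the set of parts that are raised by one. The factor `c`, which may vanish, is not absorbed in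
`w`. -/
theorem IsOrthogonalComponent.mean_hallLittlewood (h : IsOrthogonalComponent t z Δ S)
    {α β c : ℂ} {w : (Fin n → ℂ) → ℂ} (hw : ∀ x, c * w x = ∏ l, (1 - α * z x l) * (1 - β * z x l))
    (μ : Fin N → ℕ) :
    c / torusMean Δ * torusMean (fun x => hallLittlewood μ t (z x) * Δ x * w x) =
      (hlV μ t)⁻¹ * ∑ T : Finset (Fin N), (-β) ^ #T *
        componentMean t z Δ (powWeight α fun i => μ i + if i ∈ T then 1 else 0) := by
  have hint : ∀ T : Finset (Fin N), Integrable (fun x => (-β) ^ #T *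
      (symSum t (powWeight α fun i => μ i + if i ∈ T then 1 else 0) (z x) * Δ x))
      (torusMeasure n) := fun T => (h.integrable _ fun i => circleLip_powWeight α _ i).const_mul _
  have key : (fun x => c * (hallLittlewood μ t (z x) * Δ x * w x)) =ᵐ[torusMeasure n]
      fun x => (hlV μ t)⁻¹ * ∑ T : Finset (Fin N), (-β) ^ #T *
        (symSum t (powWeight α fun i => μ i + if i ∈ T then 1 else 0) (z x) * Δ x) := by
    filter_upwards [h.generic] with x hx
    have h1 : (∏ l, (1 - α * z x l) * (1 - β * z x l)) * hlSum μ t (z x) =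
        ∑ T : Finset (Fin N), (-β) ^ #T *
          symSum t (powWeight α fun i => μ i + if i ∈ T then 1 else 0) (z x) := by
      rw [hlSum_eq_symSum, ← symSum_mul_common t _ fun u => (1 - α * u) * (1 - β * u)]
      have h2 := symSum_mul_affine t (fun i u => u ^ μ i * (1 - α * u)) (fun _ => 1) (fun _ => 1)
        (-β) (z x)
      rw [symSum_congr t (g := fun i u => u ^ μ i * (1 - α * u) * (1 + 1 * (-β * u)))
        fun i j => by ring, h2]
      refine sum_congr rfl fun T _ => congrArg _ (symSum_congr t fun i j => ?_)
      simp only [powWeight]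
      split_ifs <;> ring
    rw [hallLittlewood, eval_hlR μ t hx.1]
    simp only [← mul_assoc _ (symSum _ _ _) (Δ x)]
    rw [← sum_mul, ← h1, ← hw]
    ring
  rw [div_mul_eq_mul_div, ← torusMean_const_mul,
    torusMean_congr_ae ((integrable_finsetSum _ fun T _ => hint T).const_mul _) key,
    torusMean_const_mul, torusMean_sum _ fun T _ => hint T, mul_div_assoc, sum_div]
  refine congrArg _ (sum_congr rfl fun T _ => ?_)
  rw [torusMean_const_mul, componentMean]
  ring

end ComponentMean

section OrthogonalGroup

variable {n n' N : ℕ} {t : ℂ}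

theorem signProd_const_one (s : ℂ) : signProd s (fun (_ : Fin N) _ => 1) = (1 + s) ^ N := by
  simp [signProd]

theorem evenSum_const_one : evenSum (fun (_ : Fin (N + 1)) _ => 1) = 2 ^ (N + 1) := by
  rw [evenSum, signProd_const_one, signProd_const_one]
  norm_num

theorem oddSum_const_one : oddSum (fun (_ : Fin (N + 1)) _ => 1) = 2 ^ (N + 1) := by
  rw [oddSum, signProd_const_one, signProd_const_one]
  norm_num

theorem pow_numOddParts (a : ℂ) (ν : Fin N → ℕ) :
    a ^ numOddParts ν = ∏ i, if Odd (ν i) then a else 1 := by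
  rw [← prod_filter, prod_const, numOddParts]

theorem signProd_powWeight (α : ℂ) (ν : Fin N → ℕ) :
    signProd 1 (powWeight α ν) = 2 ^ N * (-α) ^ numOddParts ν := by
  rw [pow_numOddParts, signProd, ← Fin.prod_const, ← prod_mul_distrib]
  refine prod_congr rfl fun i _ => ?_
  rw [powWeight, powWeight]
  split_ifs with h
  · rw [h.neg_one_pow]
    ring
  · rw [(Nat.not_odd_iff_even.1 h).neg_one_pow]
    ring

theorem numOddParts_comp_perm (ν : Fin N → ℕ) (σ : Equiv.Perm (Fin N)) :
    numOddParts (ν ∘ σ) = numOddParts ν := by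
  simp only [numOddParts, card_filter, Function.comp_apply]
  exact Equiv.sum_comp σ fun j => if Odd (ν j) then 1 else 0

/-- The factor of the Rogers-Szegő sum contributed by raising a part `v` by one. -/
noncomputable def raiseWeight (α β : ℂ) (v : ℕ) : ℂ :=
  if Odd v then β / α else α * β

theorem pow_card_mul_pow_numOddParts {α : ℂ} (hα : α ≠ 0) (β : ℂ) (μ : Fin N → ℕ)
    (T : Finset (Fin N)) :
    (-β) ^ #T * (-α) ^ numOddParts (fun i => μ i + if i ∈ T then 1 else 0) =
      (-α) ^ numOddParts μ * ∏ i ∈ T, raiseWeight α β (μ i) := by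
  rw [pow_numOddParts, pow_numOddParts, ← prod_const, ← Fintype.prod_ite_mem T,
    ← Fintype.prod_ite_mem T, ← prod_mul_distrib, ← prod_mul_distrib]
  refine prod_congr rfl fun i _ => ?_
  by_cases hi : i ∈ T
  · by_cases ho : Odd (μ i)
    · simp only [hi, ho, raiseWeight, if_true, Nat.odd_add_one, not_true_eq_false, if_false]
      field_simp
    · simp only [hi, ho, raiseWeight, if_true, Nat.odd_add_one, not_false_eq_true, if_false]
      ring
  · simp [hi]

theorem hlPhi_div_pow (m : ℕ) (t : ℂ) : hlPhi m t / (1 - t) ^ m = tFactorial t m := by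
  unfold hlPhi tFactorial tInt
  rw [prod_div_distrib, prod_const, card_range]

/-- The right-hand side as a sum over the sets `T` of parts that are raised by one, weighted by the
ascents that this creates. -/
theorem orthogonalValue_eq (ht : ‖t‖ < 1) {α : ℂ} (hα : α ≠ 0) (β : ℂ) (μ : Fin N → ℕ) :
    orthogonalValue μ α β t = (hlV μ t)⁻¹ * ∑ T : Finset (Fin N),
      (∏ a, ∏ b ∈ Ioi a, (if μ a = μ b ∧ a ∉ T ∧ b ∈ T then t else 1)) *
        (2 * tFactorial t N *
          ((-β) ^ #T * (-α) ^ numOddParts (fun i => μ i + if i ∈ T then 1 else 0))) := by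
  set M := ∑ i, μ i + 1 with hM
  have hμ : ∀ i, μ i < M := fun i =>
    Nat.lt_succ_of_le (single_le_sum (fun _ _ => Nat.zero_le _) (mem_univ i))
  have h0 : ∀ v, M ≤ v → ∀ y, rogersSzego (partMult μ v) y t = 1 := by
    intro v hv y
    rw [partMult, filter_false_of_mem fun i _ => ((hμ i).trans_le hv).ne, card_empty,
      rogersSzego_zero]
  have h1 := sum_finset_eq_prod_rogersSzego ht μ (M := 2 * M) (fun i => (hμ i).trans_le (by omega))
    (raiseWeight α β)
  have he : ∀ i, raiseWeight α β (2 * i) = α * β := fun i => if_neg (by simp)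
  have ho : ∀ i, raiseWeight α β (2 * i + 1) = β / α := fun i => if_pos (by simp)
  rw [prod_range_two_mul] at h1
  simp only [he, ho] at h1
  rw [orthogonalValue, finprod_eq_prod_range (M := M) fun i hi => h0 (2 * i) (by omega) _,
    finprod_eq_prod_range (M := M) fun i hi => h0 (2 * i + 1) (by omega) _, ← h1, ← hlPhi_div_pow,
    sum_mul, mul_sum, mul_sum]
  refine sum_congr rfl fun T _ => ?_
  rw [pow_card_mul_pow_numOddParts hα]
  simp only [div_eq_mul_inv, mul_inv]
  ring

variable {z : (Fin n → ℂ) → Fin (N + 1) → ℂ} {Δ : (Fin n → ℂ) → ℂ}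
  {z' : (Fin n' → ℂ) → Fin (N + 1) → ℂ} {Δ' : (Fin n' → ℂ) → ℂ}

/-- The sum of the means over the two components, for exponents that are a partition with some
parts raised by one. -/
theorem componentMean_add_componentMean (ht : ‖t‖ < 1)
    (h : IsOrthogonalComponent t z Δ evenSum) (h' : IsOrthogonalComponent t z' Δ' oddSum) (α : ℂ)
    (ν : Fin (N + 1) → ℕ) (hν : ∀ a b, a < b → ν b ≤ ν a + 1) :
    componentMean t z Δ (powWeight α ν) + componentMean t z' Δ' (powWeight α ν) =
      (∏ a, ∏ b ∈ Ioi a, if ν a < ν b then t else 1) *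
        (2 * tFactorial t (N + 1) * (-α) ^ numOddParts ν) := by
  refine eq_prod_mul_of_swap_of_antitone
    (L := fun ν => componentMean t z Δ (powWeight α ν) + componentMean t z' Δ' (powWeight α ν))
    (G := fun ν => 2 * tFactorial t (N + 1) * (-α) ^ numOddParts ν)
    (fun ν i hi => ?_) (fun ν hν => ?_) (fun ν σ => ?_) ν hν
  · have hi' : ∀ u, powWeight α ν i.succ u = u * powWeight α ν i.castSucc u := fun u => by
      rw [powWeight, powWeight, hi]
      ring
    rw [h.componentMean_swap (circleLip_powWeight α ν) hi',
      h'.componentMean_swap (circleLip_powWeight α ν) hi', ← mul_add]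
    rfl
  · have hf := isAdmissible_powWeight α hν
    have h2 : (2 : ℂ) ^ (N + 1) ≠ 0 := pow_ne_zero _ two_ne_zero
    rw [(h.torusMean_eq ht evenSum_const_one).2 _ hf, (h'.torusMean_eq ht oddSum_const_one).2 _ hf,
      evenSum, oddSum, signProd_powWeight]
    field_simp
    ring
  · simp only [numOddParts_comp_perm]

/-- The sum over the two components of the mean of a Hall-Littlewood polynomial times
`∏ (1 - α zₗ) (1 - β zₗ)`. -/
theorem mean_hallLittlewood_add_mean_hallLittlewood (ht : ‖t‖ < 1)
    (h : IsOrthogonalComponent t z Δ evenSum) (h' : IsOrthogonalComponent t z' Δ' oddSum)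
    {α β c c' : ℂ} (hα : α ≠ 0) {w : (Fin n → ℂ) → ℂ} {w' : (Fin n' → ℂ) → ℂ}
    (hw : ∀ x, c * w x = ∏ l, (1 - α * z x l) * (1 - β * z x l))
    (hw' : ∀ x, c' * w' x = ∏ l, (1 - α * z' x l) * (1 - β * z' x l))
    {μ : Fin (N + 1) → ℕ} (hμ : Antitone μ) :
    c / torusMean Δ * torusMean (fun x => hallLittlewood μ t (z x) * Δ x * w x) +
      c' / torusMean Δ' * torusMean (fun x => hallLittlewood μ t (z' x) * Δ' x * w' x) =
      orthogonalValue μ α β t := by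
  rw [h.mean_hallLittlewood hw, h'.mean_hallLittlewood hw', ← mul_add, ← sum_add_distrib,
    orthogonalValue_eq ht hα]
  refine congrArg _ (sum_congr rfl fun T _ => ?_)
  rw [← mul_add, componentMean_add_componentMean ht h h' α _ fun a b hab => by
    have := hμ hab.le
    split_ifs <;> omega]
  have hprod : (∏ a, ∏ b ∈ Ioi a,
      if μ a + (if a ∈ T then 1 else 0) < μ b + (if b ∈ T then 1 else 0) then t else 1) =
      ∏ a, ∏ b ∈ Ioi a, (if μ a = μ b ∧ a ∉ T ∧ b ∈ T then t else 1) := by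
    refine prod_congr rfl fun a _ => prod_congr rfl fun b hb => if_congr ?_ rfl rfl
    have := hμ (mem_Ioi.1 hb).le
    by_cases ha : a ∈ T <;> by_cases hb : b ∈ T <;> simp only [ha, hb, if_true, if_false,
      not_true_eq_false, not_false_eq_true, and_true, and_false, iff_false] <;> omega
  rw [hprod]
  ring

theorem prod_pmVars_eq_abWeight (α β : ℂ) (x : Fin n → ℂ) :
    ∏ l, (1 - α * pmVars x l) * (1 - β * pmVars x l) = abWeight α β x := by
  rw [prod_pmVars (fun u => (1 - α * u) * (1 - β * u)), abWeight]
  exact prod_congr rfl fun i _ => by ring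

end OrthogonalGroup

theorem theorem5p1 (s t α β : ℂ) (hs : s ^ 2 = t) (ht : ‖t‖ < 1) (hα : α ≠ 0) (n : ℕ) :
    -- the group `O(2n+2)`, in which `n + 1 ≥ 1` plays the role of the rank
    ((torusMean (koornwinderDensity (n := n + 1) 1 (-1) s (-s) t) ≠ 0 ∧
      torusMean (koornwinderDensity (n := n) t (-t) s (-s) t) ≠ 0) ∧
      ∀ μ : Fin (2 * (n + 1)) → ℕ, Antitone μ →
        1 / torusMean (koornwinderDensity (n := n + 1) 1 (-1) s (-s) t) *
            torusMean (fun x : Fin (n + 1) → ℂ =>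
              hallLittlewood μ t (pmVars x) *
                koornwinderDensity 1 (-1) s (-s) t x * abWeight α β x) +
          (1 - α ^ 2) * (1 - β ^ 2) / torusMean (koornwinderDensity (n := n) t (-t) s (-s) t) *
            torusMean (fun x : Fin n → ℂ =>
              hallLittlewood μ t (Fin.append (pmVars x) ![1, -1]) *
                koornwinderDensity t (-t) s (-s) t x * abWeight α β x) =
        orthogonalValue μ α β t) ∧
    -- the group `O(2n+1)`
    ((torusMean (koornwinderDensity (n := n) t (-1) s (-s) t) ≠ 0 ∧
      torusMean (koornwinderDensity (n := n) 1 (-t) s (-s) t) ≠ 0) ∧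
      ∀ μ : Fin (2 * n + 1) → ℕ, Antitone μ →
        (1 - α) * (1 - β) / torusMean (koornwinderDensity (n := n) t (-1) s (-s) t) *
            torusMean (fun x : Fin n → ℂ =>
              hallLittlewood μ t (Fin.append (pmVars x) ![1]) *
                koornwinderDensity t (-1) s (-s) t x * abWeight α β x) +
          (1 + α) * (1 + β) / torusMean (koornwinderDensity (n := n) 1 (-t) s (-s) t) *
            torusMean (fun x : Fin n → ℂ =>
              hallLittlewood μ t (Fin.append (pmVars x) ![-1]) *
                koornwinderDensity 1 (-t) s (-s) t x * abWeight α β x) =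
        orthogonalValue μ α β t) := by
  have he := isOrthogonalComponent_even ht hs (n + 1)
  have hpm := isOrthogonalComponent_one_neg_one ht hs n
  have hp := isOrthogonalComponent_one ht hs n
  have hm := isOrthogonalComponent_neg_one ht hs n
  refine ⟨⟨⟨(he.torusMean_eq ht (evenSum_const_one (N := 2 * n + 1))).1,
    (hpm.torusMean_eq ht oddSum_const_one).1⟩, fun μ hμ => ?_⟩,
    ⟨(hp.torusMean_eq ht evenSum_const_one).1, (hm.torusMean_eq ht oddSum_const_one).1⟩,
    fun μ hμ => ?_⟩
  · refine mean_hallLittlewood_add_mean_hallLittlewood (N := 2 * n + 1) ht he hpm hα (fun x => ?_)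
      (fun x => ?_) hμ
    · exact (one_mul _).trans (prod_pmVars_eq_abWeight α β x).symm
    · rw [Fin.prod_univ_add (M := ℂ) (a := 2 * n) (b := 2)]
      simp only [Fin.append_left, Fin.append_right, prod_pmVars_eq_abWeight, Fin.prod_univ_two,
        Matrix.cons_val_zero, Matrix.cons_val_one]
      ring
  · refine mean_hallLittlewood_add_mean_hallLittlewood ht hp hm hα (fun x => ?_) (fun x => ?_) hμ
    all_goals
      rw [Fin.prod_univ_add]
      simp only [Fin.append_left, Fin.append_right, prod_pmVars_eq_abWeight, univ_unique,
        prod_singleton, Matrix.cons_val_fin_one]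
      ring
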